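/- Let $N\ge 1$ and let $D\subset\mathbb R^N$ be a bounded domain with smooth boundary, given by a smooth function $\psi$ with $D=\{\psi>0\}$, $\partial D=\{\psi=0\}$ and $|\nabla\psi|=1$ on $\partial D$; let $\sigma$ be the surface measure on $\partial D$. Let $K,k,\beta',B,Q$ be real numbers with $k<\tfrac12$. Then there is $\alpha_0\in\mathbb R$, depending only on $D$ and $K,k,\beta',B,Q$, such that the following holds. Let $\alpha\ge\alpha_0$ and $\beta,M$ be real numbers with $\alpha,\beta,K,M,k,\beta'>0$ and $K^2<2\alpha$. Let $b:\mathbb R^N\to\mathbb R^N$ be Lipschitz with $|b|\le B$, let $q:\mathbb R^N\to\mathbb R$ be measurable, bounded on $D$, with $q\le Q$ on $D$, and let $f:\mathbb R^N\times\mathbb R\times\mathbb R^N\to\mathbb R$, $g:\mathbb R^N\times\mathbb R\times\mathbb R^N\to\mathbb R^N$, $h:\mathbb R^N\times\mathbb R\to\mathbb R$ be measurable functions such that for almost every $x\in D$ (in the conditions on $f,g$), respectively $\sigma$-almost every $x\in\partial D$ (in the conditions on $h$), and all $y,y'\in\mathbb R$, $z,z'\in\mathbb R^N$: (i) $(y-y')(f(x,y,z)-f(x,y',z))\le-\alpha|y-y'|^2$;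 (ii) $(y-y')(h(x,y)-h(x,y'))\le-\beta|y-y'|^2$; (iii) $|f(x,y,z)-f(x,y,z')|\le K|z-z'|$; (iv) $f(x,\cdot,z)$ and $h(x,\cdot)$ are continuous; (v) $|f(x,y,z)|\le M(1+|y|+|z|)$, $|h(x,y)|\le M(1+|y|)$, $|g(x,y,z)|\le M$; (vi) $|g(x,y,z)-g(x,y',z')|\le k(|y-y'|+|z-z'|)$; (vii) $|h(x,y)-h(x,y')|\le\beta'|y-y'|$. Let $s\in\{1,-1\}$, and let $\vec n$ be the unit normal field on $\partial D$ that points inward if $s=1$ and outward if $s=-1$. Then the Neumann problem $$\tfrac12\Delta u+\langle b,\nabla u\rangle+qu-\operatorname{div}(g(\cdot,u,\nabla u))+f(\cdot,u,\nabla u)=0\ \text{ on }D,\qquad \langle\nabla u-2g(\cdot,u,\nabla u),\vec n\rangle+h(\cdot,u)=0\ \text{ on }\partial D$$ has a weak solution $u\in H^1(D)$, and it is unique (up to equality almost everywhere on $D$). Here $u\in H^1(D)$ is a weak solution if for every $\phi\in C^\infty(\overline D)$ (the restriction to $\overline D$ of a smooth function on $\mathbb R^N$) $$\tfrac12\int_D\langle\nabla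 u,\nabla\phi\rangle dx-\int_D\langle b,\nabla u\rangle\phi\,dx-\int_D q\,u\,\phi\,dx=\int_D f(x,u,\nabla u)\phi\,dx+\int_D\langle g(x,u,\nabla u),\nabla\phi\rangle dx+\frac s2\int_{\partial D}h(x,\operatorname{Tr}u)\,\phi\,d\sigma,$$ where $\operatorname{Tr}u\in L^2(\partial D,\sigma)$ is the trace of $u$, i.e. the limit in $L^2(\partial D,\sigma)$ of $\varphi_n|_{\partial D}$ for smooth functions $\varphi_n$ on $\mathbb R^N$ that converge to $u$ in $H^1(D)$. -/

import Mathlib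

open MeasureTheory Filter Topology Set
open scoped ContDiff Gradient ENNReal

noncomputable section

namespace NeumannProblem

/-- The Euclidean space `ℝ^N`. -/
abbrev Euc (N : ℕ) : Type := EuclideanSpace ℝ (Fin N)

/-- A bounded domain (non-empty, open, connected) with smooth boundary, described by a smooth
function `ψ` with `D = {ψ > 0}`, `∂D = {ψ = 0}` and `|∇ψ| = 1` on `∂D`, so that `∇ψ` is the inward
unit normal there. -/
structure IsSmoothDomain {N : ℕ} (D : Set (Euc N)) : Prop where
  isOpen : IsOpen D
  isConnected : IsConnected D
  isBounded : Bornology.IsBounded D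
  exists_defining : ∃ ψ : Euc N → ℝ, ContDiff ℝ ∞ ψ ∧ D = {x | 0 < ψ x} ∧
    frontier D = {x | ψ x = 0} ∧ ∀ x ∈ frontier D, ‖∇ ψ x‖ = 1

/-- The surface measure on `∂D`: the `(N-1)`-dimensional Hausdorff measure, normalized as Lebesgue
measure, restricted to `∂D`. -/
def surfaceMeasure {N : ℕ} (D : Set (Euc N)) : Measure (Euc N) :=
  (Measure.euclideanHausdorffMeasure (N - 1)).restrict (frontier D)

/-- `G` is the weak (distributional) gradient of `u` on `D`. -/
def IsWeakGradient {N : ℕ} (D : Set (Euc N)) (u : Euc N → ℝ) (G : Euc N → Euc N) : Prop :=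
  ∀ φ : Euc N → ℝ, ContDiff ℝ ∞ φ → HasCompactSupport φ → tsupport φ ⊆ D →
    ∫ x in D, u x • ∇ φ x = - ∫ x in D, φ x • G x

/-- `u` belongs to the Sobolev space `H¹(D)` and `G` is its gradient. -/
structure MemH1With {N : ℕ} (D : Set (Euc N)) (u : Euc N → ℝ) (G : Euc N → Euc N) : Prop where
  memLp : MemLp u 2 (volume.restrict D)
  memLp_grad : MemLp G 2 (volume.restrict D)
  isWeakGradient : IsWeakGradient D u G

/-- `T ∈ L²(∂D)` is the trace on `∂D` of the function `u ∈ H¹(D)` with gradient `G`: the limit in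
`L²(∂D)` of the restrictions of smooth functions on `ℝ^N` that converge to `u` in `H¹(D)`. -/
def IsTrace {N : ℕ} (D : Set (Euc N)) (u : Euc N → ℝ) (G : Euc N → Euc N) (T : Euc N → ℝ) :
    Prop :=
  MemLp T 2 (surfaceMeasure D) ∧
  ∃ φ : ℕ → Euc N → ℝ, (∀ n, ContDiff ℝ ∞ (φ n)) ∧
    Tendsto (fun n => eLpNorm (fun x => φ n x - u x) 2 (volume.restrict D)) atTop (𝓝 0) ∧
    Tendsto (fun n => eLpNorm (fun x => ∇ (φ n) x - G x) 2 (volume.restrict D)) atTop (𝓝 0) ∧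
    Tendsto (fun n => eLpNorm (fun x => φ n x - T x) 2 (surfaceMeasure D)) atTop (𝓝 0)

/-- The conditions on the nonlinearities `f`, `h`, `g`; those on `f` and `g` are required for almost
every `x ∈ D`, those on `h` for almost every `x ∈ ∂D`. -/
structure Conditions {N : ℕ} (D : Set (Euc N)) (α β K M k β' : ℝ)
    (f : Euc N → ℝ → Euc N → ℝ) (h : Euc N → ℝ → ℝ) (g : Euc N → ℝ → Euc N → Euc N) :
    Prop where
  pos_α : 0 < α
  pos_β : 0 < β
  pos_K : 0 < K
  pos_M : 0 < M
  pos_k : 0 < k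
  pos_β' : 0 < β'
  sq_K_lt : K ^ 2 < 2 * α
  measurable_f : Measurable fun p : Euc N × ℝ × Euc N => f p.1 p.2.1 p.2.2
  measurable_h : Measurable fun p : Euc N × ℝ => h p.1 p.2
  measurable_g : Measurable fun p : Euc N × ℝ × Euc N => g p.1 p.2.1 p.2.2
  monotone_f : ∀ᵐ x ∂(volume.restrict D), ∀ y y' z,
    (y - y') * (f x y z - f x y' z) ≤ -α * |y - y'| ^ 2
  monotone_h : ∀ᵐ x ∂(surfaceMeasure D), ∀ y y',
    (y - y') * (h x y - h x y') ≤ -β * |y - y'| ^ 2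
  lipschitz_f : ∀ᵐ x ∂(volume.restrict D), ∀ y z z', |f x y z - f x y z'| ≤ K * ‖z - z'‖
  continuous_f : ∀ᵐ x ∂(volume.restrict D), ∀ z, Continuous fun y => f x y z
  continuous_h : ∀ᵐ x ∂(surfaceMeasure D), Continuous fun y => h x y
  growth_f : ∀ᵐ x ∂(volume.restrict D), ∀ y z, |f x y z| ≤ M * (1 + |y| + ‖z‖)
  growth_h : ∀ᵐ x ∂(surfaceMeasure D), ∀ y, |h x y| ≤ M * (1 + |y|)
  bounded_g : ∀ᵐ x ∂(volume.restrict D), ∀ y z, ‖g x y z‖ ≤ M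
  lipschitz_g : ∀ᵐ x ∂(volume.restrict D), ∀ y y' z z',
    ‖g x y z - g x y' z'‖ ≤ k * (|y - y'| + ‖z - z'‖)
  lipschitz_h : ∀ᵐ x ∂(surfaceMeasure D), ∀ y y', |h x y - h x y'| ≤ β' * |y - y'|

/-- `u ∈ H¹(D)` is a weak solution of
`½Δu + ⟨b, ∇u⟩ + q u - div g(·, u, ∇u) + f(·, u, ∇u) = 0` on `D`,
`⟨∇u - 2 g(·, u, ∇u), n⟩ + h(·, u) = 0` on `∂D`,
where `n` is the inward unit normal for `s = 1` and the outward unit normal for `s = -1`.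
Test functions are the restrictions to `D` of smooth functions on `ℝ^N`; the boundary term involves
the trace `T` of `u`. -/
def IsWeakSolution {N : ℕ} (D : Set (Euc N)) (s : ℝ) (b : Euc N → Euc N) (q : Euc N → ℝ)
    (f : Euc N → ℝ → Euc N → ℝ) (h : Euc N → ℝ → ℝ) (g : Euc N → ℝ → Euc N → Euc N)
    (u : Euc N → ℝ) : Prop :=
  ∃ (G : Euc N → Euc N) (T : Euc N → ℝ), MemH1With D u G ∧ IsTrace D u G T ∧
    ∀ φ : Euc N → ℝ, ContDiff ℝ ∞ φ →
      1 / 2 * (∫ x in D, inner ℝ (G x) (∇ φ x)) - (∫ x in D, inner ℝ (b x) (G x) * φ x)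
          - (∫ x in D, q x * u x * φ x)
        = (∫ x in D, f x (u x) (G x) * φ x) + (∫ x in D, inner ℝ (g x (u x) (G x)) (∇ φ x))
          + s / 2 * ∫ x, h x (T x) * φ x ∂(surfaceMeasure D)

end NeumannProblem

end

/-!
The proof is monotone operator theory in the Hilbert space of triples `(u, ∇u, Tr u)`.

Let `V` be the closure in `L²(D) × L²(D; ℝ^N) × L²(∂D)` of the triples `(φ, ∇φ, φ|∂D)` of smooth
functions `φ` (`sobolevTriples`). By the definition of the trace, the weak solutions are exactly the
elements `U` of `V` with `⟪A U, W⟫ = 0` for all `W` in `V`, where `A` is the superposition operator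
`tripleOp` built from the coefficients; smooth test functions suffice by density
(`IsAdmissible.isWeakSolution`, `IsAdmissible.exists_triple`). No density theorem for `H¹(D)` is
needed.

The operator is strongly monotone on `V` once `α` is large. In the interior, `k < 1/2` leaves a
positive multiple of `‖∇w‖²`, which absorbs the terms of first order at the cost of a multiple of
`‖w‖²`, and `α` pays for that (`Conditions.ae_le_interior`). On the boundary the term with `h` is at
least `-(β'/2) ‖Tr w‖²` for either sign `s`, and the trace inequality
`‖Tr w‖² ≤ C_ε ‖w‖² + ε ‖∇w‖²` (`IsSmoothDomain.exists_trace_le`) reduces it to interior terms.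
Since `f` is only continuous in `y`, the operator need not be Lipschitz; it is continuous along
lines by dominated convergence, and the Browder–Minty theorem
(`exists_eq_zero_of_stronglyMonotone`) gives the solution. Uniqueness is strong monotonicity again.

The trace inequality is proved without the divergence theorem. Near a boundary point some coordinate
direction `e` is transversal to `∂D`: segments in direction `e` from boundary points stay in `D`,
and projection along `e` restricted to `∂D` has a Lipschitz inverse, so that it maps surface measure
to at most a multiple of Lebesgue measure (`IsSmoothDomain.exists_transversal`,
`exists_map_forgetCoord_le`). The fundamental theorem of calculus on the segments and Tonelli's
theorem give the inequality near the point, and `∂D` is compact.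

The Browder–Minty theorem rests on the Debrunner–Flor lemma. For finitely many points the lemma is
the first-order optimality condition of a quadratic minimization on a simplex; the general case
follows by weak compactness, as the sets involved are closed balls.
-/

/-! ### Monotone operators on Hilbert spaces -/

section Monotone

variable {H : Type*} [NormedAddCommGroup H] [InnerProductSpace ℝ H]

/-- For a weight `w` on finitely many pairs `(x i, y i)` that are pairwise monotone, the covariance
of `x` and `y` is nonnegative. -/
theorem inner_sum_smul_le_sum_mul_inner {ι : Type*} [Fintype ι] (x y : ι → H)
    (hxy : ∀ i j, 0 ≤ inner ℝ (x i - x j) (y i - y j)) (w : ι → ℝ) (hw : w ∈ stdSimplex ℝ ι) :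
    inner ℝ (∑ i, w i • x i) (∑ i, w i • y i) ≤ ∑ i, w i * inner ℝ (x i) (y i) := by
  have h1 : 0 ≤ ∑ i, ∑ j, w i * w j * inner ℝ (x i - x j) (y i - y j) :=
    Finset.sum_nonneg fun i _ => Finset.sum_nonneg fun j _ =>
      mul_nonneg (mul_nonneg (hw.1 i) (hw.1 j)) (hxy i j)
  have hA : ∑ i, ∑ j, w i * w j * inner ℝ (x i) (y i) = ∑ i, w i * inner ℝ (x i) (y i) := by
    refine Finset.sum_congr rfl fun i _ => ?_
    calc ∑ j, w i * w j * inner ℝ (x i) (y i) = (∑ j, w j) * (w i * inner ℝ (x i) (y i)) := by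
          rw [Finset.sum_mul]; exact Finset.sum_congr rfl fun j _ => by ring
      _ = _ := by rw [hw.2, one_mul]
  have hB : ∑ i, ∑ j, w i * w j * inner ℝ (x j) (y j) = ∑ i, w i * inner ℝ (x i) (y i) := by
    rw [Finset.sum_comm, ← hA]
    exact Finset.sum_congr rfl fun i _ => Finset.sum_congr rfl fun j _ => by ring
  have hD : ∑ i, ∑ j, w i * w j * inner ℝ (x j) (y i) =
      inner ℝ (∑ i, w i • x i) (∑ i, w i • y i) := by
    simp only [sum_inner, inner_sum, real_inner_smul_left, real_inner_smul_right, mul_assoc]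
  have hC : ∑ i, ∑ j, w i * w j * inner ℝ (x i) (y j) =
      inner ℝ (∑ i, w i • x i) (∑ i, w i • y i) := by
    rw [Finset.sum_comm, ← hD]
    exact Finset.sum_congr rfl fun i _ => Finset.sum_congr rfl fun j _ => by ring
  have h2 : ∑ i, ∑ j, w i * w j * inner ℝ (x i - x j) (y i - y j) =
      2 * (∑ i, w i * inner ℝ (x i) (y i)) -
        2 * inner ℝ (∑ i, w i • x i) (∑ i, w i • y i) := by
    calc _ = ∑ i, ∑ j, w i * w j * inner ℝ (x i) (y i) + ∑ i, ∑ j, w i * w j * inner ℝ (x j) (y j)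
          - ∑ i, ∑ j, w i * w j * inner ℝ (x i) (y j)
          - ∑ i, ∑ j, w i * w j * inner ℝ (x j) (y i) := by
          simp only [← Finset.sum_add_distrib, ← Finset.sum_sub_distrib, inner_sub_left,
            inner_sub_right]
          exact Finset.sum_congr rfl fun i _ => Finset.sum_congr rfl fun j _ => by ring
      _ = _ := by rw [hA, hB, hC, hD]; ring
  linarith

/-- The Debrunner–Flor lemma for finitely many pairwise monotone pairs. The point is
`∑ i, w i • (x i - y i) / 2`, where `w` minimizes the dual functional
`w ↦ ‖∑ i, w i • (x i - y i) / 2‖ ^ 2 + ∑ i, w i * ⟪x i, y i⟫` on the simplex. -/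
theorem exists_forall_inner_sub_add_nonpos {ι : Type*} [Fintype ι] [Nonempty ι] (x y : ι → H)
    (hxy : ∀ i j, 0 ≤ inner ℝ (x i - x j) (y i - y j)) :
    ∃ p : H, ∀ i, inner ℝ (p - x i) (y i + p) ≤ 0 := by
  classical
  set m : ι → H := fun i => (1 / 2 : ℝ) • (x i - y i) with hm
  set c : ι → ℝ := fun i => inner ℝ (x i) (y i) with hc
  set Φ : (ι → ℝ) → ℝ := fun w => ‖∑ i, w i • m i‖ ^ 2 + ∑ i, w i * c i with hΦ
  have hcont : Continuous Φ := by fun_prop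
  obtain ⟨w, hw, hmin⟩ := (isCompact_stdSimplex ℝ ι).exists_isMinOn
    ⟨_, single_mem_stdSimplex ℝ (Classical.arbitrary ι)⟩ hcont.continuousOn
  set p := ∑ i, w i • m i with hp
  set γ := ∑ i, w i * c i with hγ
  -- the dual functional is nonnegative on the simplex
  have hnonneg : 0 ≤ ‖p‖ ^ 2 + γ := by
    have h1 := inner_sum_smul_le_sum_mul_inner x y hxy w hw
    set X := ∑ i, w i • x i
    set Y := ∑ i, w i • y i
    have h2 : p = (1 / 2 : ℝ) • (X - Y) := by
      simp only [hp, hm, X, Y, ← Finset.sum_sub_distrib, Finset.smul_sum, ← smul_sub]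
      exact Finset.sum_congr rfl fun i _ => smul_comm _ _ _
    have h3 : ‖p‖ ^ 2 = ‖X + Y‖ ^ 2 / 4 - inner ℝ X Y := by
      rw [h2, norm_smul, mul_pow, norm_sub_sq_real, norm_add_sq_real]
      norm_num
      ring
    have h4 : 0 ≤ ‖X + Y‖ ^ 2 / 4 := by positivity
    linarith
  refine ⟨p, fun j => ?_⟩
  -- first-order optimality of `w` in the direction of the `j`-th vertex
  have hopt : 0 ≤ 2 * inner ℝ p (m j - p) + (c j - γ) := by
    have key : ∀ t ∈ Ioo (0 : ℝ) 1,
        0 ≤ 2 * inner ℝ p (m j - p) + (c j - γ) + t * ‖m j - p‖ ^ 2 := by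
      rintro t ⟨ht0, ht1⟩
      have hmem : (1 - t) • w + t • (Pi.single j 1 : ι → ℝ) ∈ stdSimplex ℝ ι :=
        convex_stdSimplex ℝ ι hw (single_mem_stdSimplex ℝ j) (by linarith) ht0.le (by ring)
      have h1 : Φ w ≤ Φ ((1 - t) • w + t • (Pi.single j 1 : ι → ℝ)) := hmin hmem
      have h2 : ∑ i, ((1 - t) • w + t • (Pi.single j 1 : ι → ℝ)) i • m i = p + t • (m j - p) := by
        simp only [Pi.add_apply, Pi.smul_apply, smul_eq_mul, add_smul, Finset.sum_add_distrib,
          mul_smul, ← Finset.smul_sum]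
        rw [← hp]
        simp only [Pi.single_apply, ite_smul, one_smul, zero_smul, Finset.sum_ite_eq',
          Finset.mem_univ, if_true]
        module
      have h3 : ∑ i, ((1 - t) • w + t • (Pi.single j 1 : ι → ℝ)) i * c i = γ + t * (c j - γ) := by
        simp only [Pi.add_apply, Pi.smul_apply, smul_eq_mul, add_mul, Finset.sum_add_distrib,
          mul_assoc, ← Finset.mul_sum]
        rw [← hγ]
        simp only [Pi.single_apply, ite_mul, one_mul, zero_mul, Finset.sum_ite_eq',
          Finset.mem_univ, if_true]
        ring
      simp only [hΦ] at h1
      rw [h2, h3, norm_add_sq_real, norm_smul, real_inner_smul_right, ← hp, ← hγ, mul_pow,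
        Real.norm_eq_abs, sq_abs] at h1
      have h4 : 0 ≤ t * (2 * inner ℝ p (m j - p) + (c j - γ) + t * ‖m j - p‖ ^ 2) := by
        linarith
      exact nonneg_of_mul_nonneg_right h4 ht0
    have hlim : Tendsto (fun t : ℝ => 2 * inner ℝ p (m j - p) + (c j - γ) + t * ‖m j - p‖ ^ 2)
        (𝓝[>] 0) (𝓝 (2 * inner ℝ p (m j - p) + (c j - γ) + 0 * ‖m j - p‖ ^ 2)) := by
      apply Tendsto.mono_left _ nhdsWithin_le_nhds
      exact Continuous.tendsto (by fun_prop) 0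
    rw [zero_mul, add_zero] at hlim
    exact ge_of_tendsto hlim (Filter.mem_of_superset (Ioo_mem_nhdsGT one_pos) key)
  have h5 : inner ℝ (p - x j) (y j + p) = ‖p‖ ^ 2 - 2 * inner ℝ p (m j) - c j := by
    simp only [hm, hc, inner_sub_left, inner_add_right, real_inner_smul_right, inner_sub_right,
      real_inner_self_eq_norm_sq, real_inner_comm p (x j)]
    ring
  rw [inner_sub_right, real_inner_self_eq_norm_sq] at hopt
  rw [h5]
  linarith

/-- The set `{p | ⟪p - x, y + p⟫ ≤ 0}` is the ball with centre `(x - y) / 2` and radius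
`‖x + y‖ / 2`. -/
theorem inner_sub_add_nonpos_iff_mem_closedBall (x y p : H) :
    inner ℝ (p - x) (y + p) ≤ 0 ↔
      p ∈ Metric.closedBall ((1 / 2 : ℝ) • (x - y)) (‖x + y‖ / 2) := by
  have h1 : ‖p - (1 / 2 : ℝ) • (x - y)‖ ^ 2 =
      inner ℝ (p - x) (y + p) + (‖x + y‖ / 2) ^ 2 := by
    rw [norm_sub_sq_real, norm_smul, div_pow, mul_pow, norm_sub_sq_real, norm_add_sq_real]
    simp only [inner_sub_left, inner_add_right, real_inner_smul_right, inner_sub_right,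
      real_inner_self_eq_norm_sq, real_inner_comm p x]
    norm_num
    ring
  rw [mem_closedBall_iff_norm, ← sq_le_sq₀ (norm_nonneg _) (by positivity), h1]
  constructor <;> intro h <;> linarith

variable [CompleteSpace H]

/-- The Debrunner–Flor lemma for a monotone operator, from the finite one by weak compactness of
balls. -/
theorem exists_forall_inner_sub_add_nonpos_of_monotone (T : H → H)
    (hT : ∀ x y, 0 ≤ inner ℝ (T x - T y) (x - y)) :
    ∃ p : H, ∀ x, inner ℝ (p - x) (T x + p) ≤ 0 := by
  classical
  set C : H → Set (WeakDual ℝ H) := fun x => WeakDual.toStrongDual ⁻¹'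
    Metric.closedBall (InnerProductSpace.toDual ℝ H ((1 / 2 : ℝ) • (x - T x))) (‖x + T x‖ / 2)
    with hC
  have hmem : ∀ (p x : H), WeakDual.toStrongDual.symm (InnerProductSpace.toDual ℝ H p) ∈ C x ↔
      inner ℝ (p - x) (T x + p) ≤ 0 := by
    intro p x
    rw [inner_sub_add_nonpos_iff_mem_closedBall]
    simp only [hC, mem_preimage, LinearEquiv.apply_symm_apply, Metric.mem_closedBall,
      LinearIsometryEquiv.dist_map]
  have hcompact : IsCompact (C 0) := WeakDual.isCompact_closedBall _ _
  have hclosed : ∀ x, IsClosed (C x) := fun x => WeakDual.isClosed_closedBall _ _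
  obtain ⟨ℓ, -, hℓ⟩ := hcompact.inter_iInter_nonempty C hclosed (by
    intro u
    have : Nonempty ↥(insert (0 : H) u) := ⟨⟨0, Finset.mem_insert_self _ _⟩⟩
    obtain ⟨p, hp⟩ := exists_forall_inner_sub_add_nonpos
      (fun i : ↥(insert (0 : H) u) => (i : H)) (fun i => T i)
      (fun i j => by rw [real_inner_comm]; exact hT i j)
    refine ⟨WeakDual.toStrongDual.symm (InnerProductSpace.toDual ℝ H p), ?_, ?_⟩
    · exact (hmem p 0).2 (hp ⟨0, Finset.mem_insert_self _ _⟩)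
    · simp only [mem_iInter]
      exact fun x hx => (hmem p x).2 (hp ⟨x, Finset.mem_insert_of_mem hx⟩))
  refine ⟨(InnerProductSpace.toDual ℝ H).symm (WeakDual.toStrongDual ℓ), fun x => ?_⟩
  rw [← hmem]
  simpa using mem_iInter.1 hℓ x

/-- The Browder–Minty theorem: a strongly monotone operator on a Hilbert space that is
hemicontinuous has a zero. -/
theorem exists_eq_zero_of_stronglyMonotone (A : H → H) {c : ℝ} (hc : 0 < c)
    (hA : ∀ x y, c * ‖x - y‖ ^ 2 ≤ inner ℝ (A x - A y) (x - y))
    (hcont : ∀ x v, Tendsto (fun t : ℝ => inner ℝ (A (x + t • v)) v) (𝓝[>] 0)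
      (𝓝 (inner ℝ (A x) v))) :
    ∃ x, A x = 0 := by
  -- `c⁻¹ • A` is the identity plus a monotone operator `T`
  set T : H → H := fun x => c⁻¹ • A x - x with hTdef
  obtain ⟨p, hp⟩ := exists_forall_inner_sub_add_nonpos_of_monotone T (by
    intro x y
    have h1 : T x - T y = c⁻¹ • (A x - A y) - (x - y) := by simp only [hTdef]; module
    rw [h1, inner_sub_left, real_inner_smul_left, real_inner_self_eq_norm_sq]
    have h2 := mul_le_mul_of_nonneg_left (hA x y) (inv_nonneg.2 hc.le)
    rw [inv_mul_cancel_left₀ hc.ne'] at h2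
    linarith)
  refine ⟨p, ?_⟩
  have key : ∀ v, 0 ≤ inner ℝ (A p) v := by
    intro v
    have h1 : ∀ t ∈ Ioi (0 : ℝ), 0 ≤ inner ℝ (A (p + t • v)) v - c * (t * ‖v‖ ^ 2) := by
      intro t ht
      have ht : 0 < t := ht
      have h2 := hp (p + t • v)
      have h3 : p - (p + t • v) = (-t) • v := by module
      have h4 : T (p + t • v) + p = c⁻¹ • A (p + t • v) - t • v := by simp only [hTdef]; module
      rw [h3, h4, real_inner_smul_left, inner_sub_right, real_inner_smul_right,
        real_inner_smul_right, real_inner_self_eq_norm_sq, real_inner_comm] at h2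
      have h5 : 0 ≤ (t * c⁻¹) * (inner ℝ (A (p + t • v)) v - c * (t * ‖v‖ ^ 2)) := by
        rw [mul_sub, mul_assoc t, mul_assoc t, inv_mul_cancel_left₀ hc.ne']
        linarith
      exact nonneg_of_mul_nonneg_right h5 (by positivity)
    have hlim : Tendsto (fun t : ℝ => inner ℝ (A (p + t • v)) v - c * (t * ‖v‖ ^ 2)) (𝓝[>] 0)
        (𝓝 (inner ℝ (A p) v - c * (0 * ‖v‖ ^ 2))) :=
      (hcont p v).sub ((Continuous.tendsto (by fun_prop) 0).mono_left nhdsWithin_le_nhds)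
    simp only [zero_mul, mul_zero, sub_zero] at hlim
    exact ge_of_tendsto hlim (Filter.mem_of_superset self_mem_nhdsWithin h1)
  have h6 := key (-A p)
  rw [inner_neg_right, real_inner_self_eq_norm_sq] at h6
  have h7 : ‖A p‖ ^ 2 = 0 := le_antisymm (by linarith) (by positivity)
  simpa using h7

/-- A strongly monotone hemicontinuous equation, tested by a complete subspace `V`, has exactly one
solution in `V`. -/
theorem Submodule.exists_unique_inner_eq_zero_of_stronglyMonotone {E : Type*}
    [NormedAddCommGroup E] [InnerProductSpace ℝ E] (V : Submodule ℝ E) [CompleteSpace V]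
    (A : E → E) {c : ℝ} (hc : 0 < c)
    (hA : ∀ x ∈ V, ∀ y ∈ V, c * ‖x - y‖ ^ 2 ≤ inner ℝ (A x - A y) (x - y))
    (hcont : ∀ x ∈ V, ∀ v ∈ V, Tendsto (fun t : ℝ => inner ℝ (A (x + t • v)) v) (𝓝[>] 0)
      (𝓝 (inner ℝ (A x) v))) :
    ∃ x ∈ V, (∀ v ∈ V, inner ℝ (A x) v = 0) ∧
      ∀ y ∈ V, (∀ v ∈ V, inner ℝ (A y) v = 0) → y = x := by
  set A' : V → V := fun x => V.orthogonalProjectionOnto (A x) with hA'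
  have hinner : ∀ x v : V, inner ℝ (A' x) v = inner ℝ (A x) (v : E) := fun x v =>
    V.inner_orthogonalProjectionOnto_eq_of_mem_right v (A x)
  obtain ⟨x, hx⟩ := exists_eq_zero_of_stronglyMonotone A' hc
    (fun x y => by
      rw [inner_sub_left, hinner, hinner, ← inner_sub_left]
      exact hA x x.2 y y.2)
    (fun x v => by
      simp only [hinner]
      exact hcont x x.2 v v.2)
  have hxv : ∀ v ∈ V, inner ℝ (A x) v = 0 := by
    intro v hv
    rw [← hinner x ⟨v, hv⟩, hx, inner_zero_left]
  refine ⟨x, x.2, hxv, fun y hy hyv => ?_⟩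
  have h1 := hA y hy x x.2
  rw [inner_sub_left, hyv _ (V.sub_mem hy x.2), hxv _ (V.sub_mem hy x.2), sub_zero] at h1
  have h2 : ‖y - x‖ ^ 2 ≤ 0 := nonpos_of_mul_nonpos_right h1 hc
  exact sub_eq_zero.1 (norm_eq_zero.1 (pow_eq_zero_iff two_ne_zero |>.1
    (le_antisymm h2 (sq_nonneg _))))

end Monotone

/-! ### The trace inequality -/

namespace NeumannProblem

/-- The projection of `ℝ^(n+1)` that forgets the `i`-th coordinate. -/
def forgetCoord {n : ℕ} (i : Fin (n + 1)) (x : Euc (n + 1)) : Fin n → ℝ :=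
  fun j => x (i.succAbove j)

theorem continuous_forgetCoord {n : ℕ} (i : Fin (n + 1)) : Continuous (forgetCoord i) := by
  unfold forgetCoord
  fun_prop

theorem norm_le_of_forgetCoord {n : ℕ} (i : Fin (n + 1)) (v : Euc (n + 1)) (hv : v i = 0) :
    ‖v‖ ≤ (n + 1) * ‖forgetCoord i v‖ := by
  have h1 : ∀ j, ‖v j‖ ≤ ‖forgetCoord i v‖ := by
    intro j
    rcases Fin.eq_self_or_eq_succAbove i j with rfl | ⟨l, rfl⟩
    · rw [hv, norm_zero]; exact norm_nonneg _
    · exact norm_le_pi_norm (forgetCoord i v) l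
  calc ‖v‖ = ‖∑ j, EuclideanSpace.single j (v j)‖ := by
        congr 1
        ext l
        simp [Finset.sum_apply, Pi.single_apply]
    _ ≤ ∑ j, ‖EuclideanSpace.single j (v j)‖ := norm_sum_le _ _
    _ ≤ ∑ _j : Fin (n + 1), ‖forgetCoord i v‖ := Finset.sum_le_sum fun j _ => by
        rw [PiLp.norm_single]; exact h1 j
    _ = _ := by simp

/-- Near a boundary point some coordinate direction `e` is transversal to the boundary: it points
into `D`, and the projection along `e` is injective on the boundary with Lipschitz inverse. -/
theorem IsSmoothDomain.exists_transversal {n : ℕ} {D : Set (Euc (n + 1))} (hD : IsSmoothDomain D)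
    {x₀ : Euc (n + 1)} (hx₀ : x₀ ∈ frontier D) :
    ∃ (i : Fin (n + 1)) (τ : ℝ) (r : ℝ) (L : NNReal), (τ = 1 ∨ τ = -1) ∧ 0 < r ∧
      (∀ x ∈ frontier D ∩ Metric.ball x₀ r, ∀ t ∈ Ioo 0 r,
        x + t • EuclideanSpace.single i τ ∈ D) ∧
      AntilipschitzWith L (fun x : ↥(frontier D ∩ Metric.ball x₀ r) =>
        forgetCoord i (x : Euc (n + 1))) := by
  obtain ⟨ψ, hψ, hDψ, hfr, hgrad⟩ := hD.exists_defining
  have hstrict : HasStrictFDerivAt ψ (fderiv ℝ ψ x₀) x₀ :=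
    hψ.contDiffAt.hasStrictFDerivAt (by simp)
  set ℓ := fderiv ℝ ψ x₀ with hℓ
  have hℓ0 : ℓ ≠ 0 := by
    intro h0
    have := hgrad x₀ hx₀
    rw [gradient, ← hℓ, h0, map_zero, norm_zero] at this
    exact zero_ne_one this
  obtain ⟨i, hi⟩ : ∃ i, ℓ (EuclideanSpace.single i 1) ≠ 0 := by
    by_contra! hcon
    apply hℓ0
    ext v
    have hv : v = ∑ j, v j • EuclideanSpace.single j (1 : ℝ) := by
      ext l
      simp [Finset.sum_apply, Pi.single_apply]
    rw [hv, map_sum]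
    simp [hcon]
  -- the sign `τ` makes the derivative of `ψ` in the direction `e` positive
  obtain ⟨τ, hτ, hpos⟩ : ∃ τ : ℝ, (τ = 1 ∨ τ = -1) ∧ 0 < ℓ (EuclideanSpace.single i τ) := by
    rcases lt_or_gt_of_ne hi with h | h
    · refine ⟨-1, Or.inr rfl, ?_⟩
      have : EuclideanSpace.single i (-1 : ℝ) = -EuclideanSpace.single i (1 : ℝ) := by
        ext j; by_cases hj : j = i <;> simp [hj]
      rw [this, map_neg]
      linarith
    · exact ⟨1, Or.inl rfl, h⟩
  set e := EuclideanSpace.single i τ with he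
  set a := ℓ e with ha
  have hτabs : |τ| = 1 := by rcases hτ with rfl | rfl <;> simp
  have hτsq : τ * τ = 1 := by rcases hτ with rfl | rfl <;> norm_num
  have henorm : ‖e‖ = 1 := by rw [he, PiLp.norm_single, Real.norm_eq_abs, hτabs]
  -- with error constant `a / 2` the linear part dominates along `e`
  have hlin := hstrict.isLittleO.def (half_pos hpos)
  rw [nhds_prod_eq] at hlin
  obtain ⟨U, hU, hUsub⟩ := mem_prod_self_iff.1 hlin
  have hUlin : ∀ x ∈ U, ∀ y ∈ U, ‖ψ x - ψ y - ℓ (x - y)‖ ≤ a / 2 * ‖x - y‖ :=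
    fun x hx y hy => hUsub (mk_mem_prod hx hy)
  obtain ⟨ρ, hρ, hρU⟩ := Metric.mem_nhds_iff.1 hU
  have hψ0 : ∀ x ∈ frontier D, ψ x = 0 := fun x hx => by rw [hfr] at hx; exact hx
  refine ⟨i, τ, ρ / 2, Real.toNNReal ((1 + 2 / a * (a / 2 + ‖ℓ‖)) * (n + 1)), hτ, half_pos hρ,
    ?_, ?_⟩
  · rintro x ⟨hx, hxb⟩ t ⟨ht0, htr⟩
    rw [Metric.mem_ball] at hxb
    have hx1 : x ∈ U := hρU (Metric.mem_ball.2 (by linarith))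
    have hx2 : x + t • e ∈ U := by
      refine hρU (Metric.mem_ball.2 ?_)
      calc dist (x + t • e) x₀ ≤ dist (x + t • e) x + dist x x₀ := dist_triangle _ _ _
        _ = t + dist x x₀ := by
          rw [dist_self_add_left, norm_smul, henorm, mul_one, Real.norm_eq_abs, abs_of_pos ht0]
        _ < ρ := by linarith
    have h1 := hUlin _ hx2 _ hx1
    simp only [hψ0 x hx, add_sub_cancel_left, sub_zero, map_smul, smul_eq_mul, norm_smul, henorm,
      Real.norm_eq_abs, abs_of_pos ht0, mul_one] at h1
    rw [hDψ]
    have h2 := (abs_le.1 h1).1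
    have h3 : 0 < t * a := mul_pos ht0 hpos
    change 0 < ψ (x + t • e)
    rw [← ha] at h2
    linarith
  · refine AntilipschitzWith.of_le_mul_dist ?_
    rintro ⟨x, hx, hxb⟩ ⟨y, hy, hyb⟩
    rw [Metric.mem_ball] at hxb hyb
    have hx1 : x ∈ U := hρU (Metric.mem_ball.2 (by linarith))
    have hy1 : y ∈ U := hρU (Metric.mem_ball.2 (by linarith))
    have h1 := hUlin _ hx1 _ hy1
    simp only [hψ0 x hx, hψ0 y hy, sub_self, zero_sub, norm_neg, Real.norm_eq_abs] at h1
    rw [Subtype.dist_eq, Real.coe_toNNReal _ (by positivity)]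
    set v := x - y with hv
    set s := τ * v i with hs
    set w := v - s • e with hw
    have hwi : w i = 0 := by
      simp only [hw, hs, he, PiLp.sub_apply, PiLp.smul_apply, PiLp.single_apply, if_true,
        smul_eq_mul]
      linear_combination -(v i) * hτsq
    have hPw : forgetCoord i w = forgetCoord i x - forgetCoord i y := by
      ext j
      simp [forgetCoord, hw, hv, he, Fin.succAbove_ne]
    have hwn : ‖w‖ ≤ (n + 1) * dist (forgetCoord i x) (forgetCoord i y) := by
      rw [dist_eq_norm, ← hPw]
      exact norm_le_of_forgetCoord i w hwi
    have hvw : v = w + s • e := by simp [hw]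
    have hvn : ‖v‖ ≤ ‖w‖ + |s| := by
      calc ‖v‖ ≤ ‖w‖ + ‖s • e‖ := by rw [hvw]; exact norm_add_le _ _
        _ = _ := by rw [norm_smul, henorm, mul_one, Real.norm_eq_abs]
    have h2 : |s| * a ≤ a / 2 * (‖w‖ + |s|) + ‖ℓ‖ * ‖w‖ := by
      calc |s| * a = |ℓ (s • e)| := by
            rw [map_smul, smul_eq_mul, ← ha, abs_mul s a, abs_of_pos hpos]
        _ = |ℓ v - ℓ w| := by rw [hvw, map_add]; congr 1; ring
        _ ≤ |ℓ v| + |ℓ w| := abs_sub _ _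
        _ ≤ a / 2 * ‖v‖ + ‖ℓ‖ * ‖w‖ := add_le_add h1 (ℓ.le_opNorm w)
        _ ≤ _ := by gcongr
    have h3 : |s| ≤ 2 / a * (a / 2 + ‖ℓ‖) * ‖w‖ := by
      have h4 : a / 2 * |s| ≤ (a / 2 + ‖ℓ‖) * ‖w‖ := by linarith
      calc |s| = 2 / a * (a / 2 * |s|) := by field_simp
        _ ≤ 2 / a * ((a / 2 + ‖ℓ‖) * ‖w‖) := by gcongr
        _ = _ := by ring
    calc dist x y = ‖v‖ := dist_eq_norm x y
      _ ≤ (1 + 2 / a * (a / 2 + ‖ℓ‖)) * ‖w‖ := by linarith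
      _ ≤ (1 + 2 / a * (a / 2 + ‖ℓ‖)) * ((n + 1) * dist (forgetCoord i x) (forgetCoord i y)) := by
          gcongr
      _ = _ := by ring

/-- If forgetting the `i`-th coordinate has a Lipschitz inverse on `S`, then the image of the
`n`-dimensional Hausdorff measure on `S` is at most a multiple of Lebesgue measure. -/
theorem exists_map_forgetCoord_le {n : ℕ} (i : Fin (n + 1)) {S : Set (Euc (n + 1))}
    {L : NNReal} (hL : AntilipschitzWith L (fun x : ↥S => forgetCoord i (x : Euc (n + 1)))) :
    ∃ C : NNReal, ((Measure.euclideanHausdorffMeasure n).restrict S).map (forgetCoord i) ≤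
      C • (volume : Measure (Fin n → ℝ)) := by
  rw [Measure.euclideanHausdorffMeasure_def]
  set c := Measure.addHaarScalarFactor (volume : Measure (EuclideanSpace ℝ (Fin n)))
    μH[n]
  refine ⟨c * L ^ n, Measure.le_iff.2 fun A hA => ?_⟩
  have hP : Measurable (forgetCoord i) := (continuous_forgetCoord i).measurable
  rw [Measure.map_apply hP hA, Measure.restrict_apply (hP hA)]
  have h1 : forgetCoord i ⁻¹' A ∩ S =
      Subtype.val '' ((fun x : ↥S => forgetCoord i (x : Euc (n + 1))) ⁻¹' A) := by
    ext x
    simp [and_comm]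
  have h2 := hL.hausdorffMeasure_preimage_le (d := n) (by positivity) A
  rw [h1, Measure.smul_apply,
    (isometry_subtype_coe).hausdorffMeasure_image (Or.inl (by positivity)), Measure.smul_apply]
  have h3 : (μH[n] : Measure (Fin n → ℝ)) = volume := by
    simpa using hausdorffMeasure_pi_real (ι := Fin n)
  rw [h3] at h2
  calc c • μH[n] ((fun x : ↥S => forgetCoord i (x : Euc (n + 1))) ⁻¹' A)
      ≤ c • ((L : ℝ≥0∞) ^ (n : ℝ) * volume A) := by gcongr
    _ = (c * L ^ n) • volume A := by
      rw [ENNReal.smul_def, ENNReal.smul_def, ENNReal.rpow_natCast]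
      push_cast
      rw [smul_eq_mul, smul_eq_mul, mul_assoc]

/-- Integrating over the segments that enter `D` from the points of `S` amounts to integrating
over a part of `D`. -/
theorem lintegral_segment_le {n : ℕ} {D S : Set (Euc (n + 1))} (hDo : MeasurableSet D)
    {i : Fin (n + 1)} {τ r : ℝ} (hτ : τ = 1 ∨ τ = -1)
    (hmem : ∀ x ∈ S, ∀ t ∈ Ioo 0 r, x + t • EuclideanSpace.single i τ ∈ D)
    {σ : Measure (Euc (n + 1))} (hS : MeasurableSet S) {C : NNReal}
    (hC : (σ.restrict S).map (forgetCoord i) ≤ C • (volume : Measure (Fin n → ℝ)))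
    {F : Euc (n + 1) → ℝ≥0∞} (hF : Measurable F) :
    ∫⁻ x in S, (∫⁻ t in Ioo 0 r, F (x + t • EuclideanSpace.single i τ)) ∂σ ≤
      C * ∫⁻ x in D, F x := by
  set F' := D.indicator F with hF'
  have hF'm : Measurable F' := hF.indicator hDo
  set e : (Euc (n + 1)) ≃ᵐ ℝ × (Fin n → ℝ) :=
    (MeasurableEquiv.toLp 2 (Fin (n + 1) → ℝ)).symm.trans
      (MeasurableEquiv.piFinSuccAbove (fun _ => ℝ) i) with he
  have heP : ∀ x, e x = (x i, forgetCoord i x) := fun x => rfl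
  have hemp : MeasurePreserving e volume volume :=
    (PiLp.volume_preserving_ofLp (Fin (n + 1))).trans
      (volume_preserving_piFinSuccAbove (fun _ => ℝ) i)
  set h : (Fin n → ℝ) → ℝ≥0∞ := fun y => ∫⁻ s : ℝ, F' (e.symm (s, y)) with hh
  have hme : Measurable fun p : ℝ × (Fin n → ℝ) => F' (e.symm p) := hF'm.comp e.symm.measurable
  have hhm : Measurable h := hme.lintegral_prod_left'
  have hpt : ∀ x ∈ S, ∫⁻ t in Ioo 0 r, F (x + t • EuclideanSpace.single i τ) ≤
      h (forgetCoord i x) := by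
    intro x hx
    have hcoord : ∀ t : ℝ, x + t • EuclideanSpace.single i τ =
        e.symm (x i + t * τ, forgetCoord i x) := by
      intro t
      apply e.injective
      rw [e.apply_symm_apply, heP]
      refine Prod.ext ?_ ?_
      · simp
      · ext j
        simp [forgetCoord, Fin.succAbove_ne]
    calc ∫⁻ t in Ioo 0 r, F (x + t • EuclideanSpace.single i τ)
        = ∫⁻ t in Ioo 0 r, F' (e.symm (x i + t * τ, forgetCoord i x)) := by
          refine setLIntegral_congr_fun measurableSet_Ioo fun t ht => ?_
          simp only [← hcoord]
          rw [hF', indicator_of_mem (hmem x hx t ht)]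
      _ ≤ ∫⁻ t : ℝ, F' (e.symm (x i + t * τ, forgetCoord i x)) := setLIntegral_le_lintegral _ _
      _ = h (forgetCoord i x) := by
          rcases hτ with rfl | rfl
          · simp only [mul_one]
            exact lintegral_add_left_eq_self (fun s : ℝ => F' (e.symm (s, forgetCoord i x))) (x i)
          · simp only [mul_neg, mul_one, ← sub_eq_add_neg]
            exact lintegral_sub_left_eq_self (fun s : ℝ => F' (e.symm (s, forgetCoord i x))) (x i)
  calc ∫⁻ x in S, (∫⁻ t in Ioo 0 r, F (x + t • EuclideanSpace.single i τ)) ∂σ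
      ≤ ∫⁻ x in S, h (forgetCoord i x) ∂σ := setLIntegral_mono' hS hpt
    _ = ∫⁻ y, h y ∂((σ.restrict S).map (forgetCoord i)) :=
        (lintegral_map hhm (continuous_forgetCoord i).measurable).symm
    _ ≤ ∫⁻ y, h y ∂(C • (volume : Measure (Fin n → ℝ))) := lintegral_mono' hC le_rfl
    _ = C * ∫⁻ y, h y := by rw [lintegral_smul_measure, ENNReal.smul_def, smul_eq_mul]
    _ = C * ∫⁻ p : ℝ × (Fin n → ℝ), F' (e.symm p) := by
        rw [Measure.volume_eq_prod, lintegral_prod_symm _ hme.aemeasurable]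
    _ = C * ∫⁻ x, F' x := by
        rw [← hemp.lintegral_comp hme]
        simp
    _ = C * ∫⁻ x in D, F x := by rw [lintegral_indicator hDo]

theorem norm_gradient_eq {E : Type*} [NormedAddCommGroup E] [InnerProductSpace ℝ E]
    [CompleteSpace E] (φ : E → ℝ) (x : E) : ‖∇ φ x‖ = ‖fderiv ℝ φ x‖ := by
  rw [gradient, LinearIsometryEquiv.norm_map]

theorem continuous_gradient {E : Type*} [NormedAddCommGroup E] [InnerProductSpace ℝ E]
    [CompleteSpace E] {φ : E → ℝ} (hφ : ContDiff ℝ ∞ φ) : Continuous (∇ φ) :=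
  (InnerProductSpace.toDual ℝ E).symm.continuous.comp (hφ.continuous_fderiv (by simp))

/-- The value of `φ ^ 2` at the initial point of a segment is bounded by an integral over the
segment; the weight `1 - t / r` in the fundamental theorem of calculus removes the end point. -/
theorem sq_le_integral_segment {E : Type*} [NormedAddCommGroup E] [InnerProductSpace ℝ E]
    [CompleteSpace E] {φ : E → ℝ} (hφ : ContDiff ℝ ∞ φ) (x e : E) (he : ‖e‖ = 1) {r ε : ℝ}
    (hr : 0 < r) (hε : 0 < ε) :
    φ x ^ 2 ≤ ∫ t in (0 : ℝ)..r,
      ((1 / r + 1 / ε) * φ (x + t • e) ^ 2 + ε * ‖∇ φ (x + t • e)‖ ^ 2) := by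
  set p : ℝ → ℝ := fun t => φ (x + t • e) with hp
  set p' : ℝ → ℝ := fun t => fderiv ℝ φ (x + t • e) e with hp'
  have hline : ∀ t : ℝ, HasDerivAt (fun t : ℝ => x + t • e) e t := fun t => by
    simpa using ((hasDerivAt_id t).smul_const e).const_add x
  have hder : ∀ t, HasDerivAt p (p' t) t := fun t =>
    ((hφ.differentiable (by simp) _).hasFDerivAt).comp_hasDerivAt t (hline t)
  have hcline : Continuous fun t : ℝ => x + t • e := by fun_prop
  have hpc : Continuous p := hφ.continuous.comp hcline
  have hp'c : Continuous p' :=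
    ((hφ.continuous_fderiv (by simp)).comp hcline).clm_apply continuous_const
  have hgc : Continuous fun t : ℝ => ∇ φ (x + t • e) := (continuous_gradient hφ).comp hcline
  have hFTC : ∫ t in (0 : ℝ)..r, (1 / r * p t ^ 2 - (1 - t / r) * (2 * p t * p' t)) =
      -((1 - r / r) * p r ^ 2) - (-((1 - 0 / r) * p 0 ^ 2)) := by
    refine intervalIntegral.integral_eq_sub_of_hasDerivAt
      (f := fun t => -((1 - t / r) * p t ^ 2)) (fun t _ => ?_) ?_
    · have h1 : HasDerivAt (fun t => 1 - t / r) (-(1 / r)) t := by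
        simpa using ((hasDerivAt_id t).div_const r).const_sub 1
      have h2 : HasDerivAt (fun t => p t ^ 2) (2 * p t * p' t) t := by
        simpa [Pi.pow_def] using (hder t).pow 2
      exact ((h1.mul h2).neg).congr_deriv (by ring)
    · exact Continuous.intervalIntegrable (by fun_prop) _ _
  have hp0 : φ x ^ 2 = ∫ t in (0 : ℝ)..r, (1 / r * p t ^ 2 - (1 - t / r) * (2 * p t * p' t)) := by
    rw [hFTC, div_self hr.ne']
    simp [hp]
  rw [hp0]
  refine intervalIntegral.integral_mono_on hr.le
    (Continuous.intervalIntegrable (by fun_prop) _ _)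
    (Continuous.intervalIntegrable (by fun_prop) _ _) fun t ht => ?_
  have h1 : |p' t| ≤ ‖∇ φ (x + t • e)‖ := by
    rw [norm_gradient_eq]
    simpa [he] using (fderiv ℝ φ (x + t • e)).le_opNorm e
  have h2 : |1 - t / r| ≤ 1 := by
    have h3 : t / r ≤ 1 := (div_le_one hr).2 ht.2
    have h4 : 0 ≤ t / r := div_nonneg ht.1 hr.le
    rw [abs_le]
    constructor <;> linarith
  have h5 : -((1 - t / r) * (2 * p t * p' t)) ≤ 2 * |p t| * ‖∇ φ (x + t • e)‖ := by
    calc _ ≤ |(1 - t / r) * (2 * p t * p' t)| := neg_le_abs _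
      _ = |1 - t / r| * (2 * |p t| * |p' t|) := by simp [abs_mul]
      _ ≤ 1 * (2 * |p t| * ‖∇ φ (x + t • e)‖) := by gcongr
      _ = _ := one_mul _
  have h6 : 2 * |p t| * ‖∇ φ (x + t • e)‖ ≤ 1 / ε * p t ^ 2 + ε * ‖∇ φ (x + t • e)‖ ^ 2 := by
    have h7 : 0 ≤ 1 / ε * (|p t| - ε * ‖∇ φ (x + t • e)‖) ^ 2 := by positivity
    have h8 : 1 / ε * (|p t| - ε * ‖∇ φ (x + t • e)‖) ^ 2 =
        1 / ε * p t ^ 2 + ε * ‖∇ φ (x + t • e)‖ ^ 2 - 2 * |p t| * ‖∇ φ (x + t • e)‖ := by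
      rw [sub_sq, sq_abs]
      field_simp
      ring
    linarith
  have h9 : φ (x + t • e) = p t := rfl
  rw [h9]
  linarith

/-- The trace inequality near a boundary point. -/
theorem IsSmoothDomain.exists_local_trace_inequality {n : ℕ} {D : Set (Euc (n + 1))}
    (hD : IsSmoothDomain D) {x₀ : Euc (n + 1)} (hx₀ : x₀ ∈ frontier D) :
    ∃ ρ > 0, ∀ ε : ℝ, 0 < ε → ∃ C : ℝ, 0 ≤ C ∧ ∀ φ : Euc (n + 1) → ℝ, ContDiff ℝ ∞ φ →
      ∫⁻ x in Metric.ball x₀ ρ, ENNReal.ofReal (φ x ^ 2) ∂(surfaceMeasure D) ≤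
        ∫⁻ x in D, ENNReal.ofReal (C * φ x ^ 2 + ε * ‖∇ φ x‖ ^ 2) := by
  obtain ⟨i, τ, r, L, hτ, hr, hmem, hL⟩ := hD.exists_transversal hx₀
  have hSm : MeasurableSet (frontier D ∩ Metric.ball x₀ r) :=
    isClosed_frontier.measurableSet.inter Metric.isOpen_ball.measurableSet
  obtain ⟨c, hc⟩ := exists_map_forgetCoord_le i hL
  have he : ‖EuclideanSpace.single i τ‖ = 1 := by
    rw [PiLp.norm_single]; rcases hτ with rfl | rfl <;> simp
  refine ⟨r, hr, fun ε hε => ?_⟩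
  -- the weight on the gradient is to be `ε` after multiplication by `c`
  set δ : ℝ := ε / (c + 1) with hδdef
  have hc0 : (0 : ℝ) ≤ c := c.2
  have hδ : 0 < δ := by positivity
  refine ⟨c * (1 / r + 1 / δ), by positivity, fun φ hφ => ?_⟩
  set F : Euc (n + 1) → ℝ := fun x => (1 / r + 1 / δ) * φ x ^ 2 + δ * ‖∇ φ x‖ ^ 2 with hF
  have hgc := continuous_gradient hφ
  have hφc := hφ.continuous
  have hFc : Continuous F := by fun_prop
  have hF0 : ∀ x, 0 ≤ F x := fun x => by positivity
  have hres : (surfaceMeasure D).restrict (Metric.ball x₀ r) =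
      (Measure.euclideanHausdorffMeasure n).restrict (frontier D ∩ Metric.ball x₀ r) := by
    rw [surfaceMeasure, Measure.restrict_restrict Metric.isOpen_ball.measurableSet, inter_comm]
    rfl
  rw [hres]
  calc ∫⁻ x in frontier D ∩ Metric.ball x₀ r, ENNReal.ofReal (φ x ^ 2)
        ∂(Measure.euclideanHausdorffMeasure n)
      ≤ ∫⁻ x in frontier D ∩ Metric.ball x₀ r, (∫⁻ t in Ioo 0 r,
          ENNReal.ofReal (F (x + t • EuclideanSpace.single i τ)))
          ∂(Measure.euclideanHausdorffMeasure n) := by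
        refine lintegral_mono fun x => ?_
        have hcl : Continuous fun t : ℝ => F (x + t • EuclideanSpace.single i τ) :=
          hFc.comp (by fun_prop)
        have h1 := sq_le_integral_segment hφ x (EuclideanSpace.single i τ) he hr hδ
        rw [intervalIntegral.integral_of_le hr.le, integral_Ioc_eq_integral_Ioo] at h1
        refine (ENNReal.ofReal_le_ofReal h1).trans (le_of_eq ?_)
        refine ofReal_integral_eq_lintegral_ofReal ?_ (ae_of_all _ fun t => hF0 _)
        exact (hcl.integrableOn_Icc (a := 0) (b := r)).mono_set Ioo_subset_Icc_self
    _ ≤ c * ∫⁻ x in D, ENNReal.ofReal (F x) :=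
        lintegral_segment_le hD.isOpen.measurableSet hτ hmem hSm hc
          (hFc.measurable.ennreal_ofReal)
    _ = ∫⁻ x in D, ENNReal.ofReal (c * F x) := by
        rw [← lintegral_const_mul' _ _ ENNReal.coe_ne_top]
        simp only [ENNReal.ofReal_mul hc0, ENNReal.ofReal_coe_nnreal]
    _ ≤ _ := by
        refine lintegral_mono fun x => ENNReal.ofReal_le_ofReal ?_
        have h2 : c * δ ≤ ε := by
          rw [hδdef, ← mul_div_assoc, div_le_iff₀ (by positivity)]
          nlinarith
        have h3 := mul_le_mul_of_nonneg_right h2 (sq_nonneg ‖∇ φ x‖)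
        simp only [hF]
        linarith

theorem IsSmoothDomain.isCompact_closure {N : ℕ} {D : Set (Euc N)} (hD : IsSmoothDomain D) :
    IsCompact (closure D) := hD.isBounded.isCompact_closure

theorem IsSmoothDomain.isCompact_frontier {N : ℕ} {D : Set (Euc N)} (hD : IsSmoothDomain D) :
    IsCompact (frontier D) :=
  hD.isCompact_closure.of_isClosed_subset isClosed_frontier frontier_subset_closure

/-- The trace inequality: the local inequalities add up over a finite cover of the boundary. -/
theorem IsSmoothDomain.exists_trace_inequality {N : ℕ} (hN : 1 ≤ N) {D : Set (Euc N)}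
    (hD : IsSmoothDomain D) {ε : ℝ} (hε : 0 < ε) :
    ∃ C : ℝ, 0 ≤ C ∧ ∀ φ : Euc N → ℝ, ContDiff ℝ ∞ φ →
      ∫⁻ x, ENNReal.ofReal (φ x ^ 2) ∂(surfaceMeasure D) ≤
        ∫⁻ x in D, ENNReal.ofReal (C * φ x ^ 2 + ε * ‖∇ φ x‖ ^ 2) := by
  obtain ⟨n, rfl⟩ : ∃ n, N = n + 1 := ⟨N - 1, by omega⟩
  have hfr : (surfaceMeasure D).restrict (frontier D) = surfaceMeasure D :=
    Measure.restrict_restrict_of_subset subset_rfl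
  suffices h : ∀ ε : ℝ, 0 < ε → ∃ C : ℝ, 0 ≤ C ∧ ∀ φ : Euc (n + 1) → ℝ, ContDiff ℝ ∞ φ →
      ∫⁻ x in frontier D, ENNReal.ofReal (φ x ^ 2) ∂(surfaceMeasure D) ≤
        ∫⁻ x in D, ENNReal.ofReal (C * φ x ^ 2 + ε * ‖∇ φ x‖ ^ 2) by
    rw [hfr] at h
    exact h ε hε
  refine hD.isCompact_frontier.induction_on (p := fun s => ∀ ε : ℝ, 0 < ε → ∃ C : ℝ, 0 ≤ C ∧
      ∀ φ : Euc (n + 1) → ℝ, ContDiff ℝ ∞ φ →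
      ∫⁻ x in s, ENNReal.ofReal (φ x ^ 2) ∂(surfaceMeasure D) ≤
        ∫⁻ x in D, ENNReal.ofReal (C * φ x ^ 2 + ε * ‖∇ φ x‖ ^ 2)) ?_ ?_ ?_ ?_
  · exact fun ε _ => ⟨0, le_rfl, fun φ _ => by simp⟩
  · intro s t hst ht ε hε
    obtain ⟨C, hC, h⟩ := ht ε hε
    exact ⟨C, hC, fun φ hφ => (lintegral_mono_set hst).trans (h φ hφ)⟩
  · intro s t hs ht ε hε
    obtain ⟨C₁, hC₁, h₁⟩ := hs (ε / 2) (half_pos hε)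
    obtain ⟨C₂, hC₂, h₂⟩ := ht (ε / 2) (half_pos hε)
    refine ⟨C₁ + C₂, by positivity, fun φ hφ => ?_⟩
    have hgc := continuous_gradient hφ
    have hφc := hφ.continuous
    refine (lintegral_union_le _ _ _).trans ((add_le_add (h₁ φ hφ) (h₂ φ hφ)).trans (le_of_eq ?_))
    rw [← lintegral_add_left (Continuous.measurable (by fun_prop)).ennreal_ofReal]
    refine lintegral_congr fun x => ?_
    rw [← ENNReal.ofReal_add (by positivity) (by positivity)]
    congr 1
    ring
  · intro x hx
    obtain ⟨ρ, hρ, h⟩ := hD.exists_local_trace_inequality hx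
    exact ⟨Metric.ball x ρ, mem_nhdsWithin_of_mem_nhds (Metric.ball_mem_nhds x hρ), h⟩

/-- The boundary has finite surface measure, by the trace inequality for the constant `1`. -/
theorem IsSmoothDomain.isFiniteMeasure_surfaceMeasure {N : ℕ} (hN : 1 ≤ N) {D : Set (Euc N)}
    (hD : IsSmoothDomain D) : IsFiniteMeasure (surfaceMeasure D) := by
  obtain ⟨C, hC, h⟩ := hD.exists_trace_inequality hN one_pos
  have h1 := h (fun _ => 1) contDiff_const
  have h2 : ∀ x : Euc N, ∇ (fun _ : Euc N => (1 : ℝ)) x = 0 := fun x => by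
    simp [gradient]
  simp only [h2, one_pow, norm_zero, ENNReal.ofReal_one, lintegral_one, lintegral_const,
    Measure.restrict_apply MeasurableSet.univ, univ_inter] at h1
  refine ⟨h1.trans_lt (ENNReal.mul_lt_top ENNReal.ofReal_lt_top ?_)⟩
  exact hD.isBounded.measure_lt_top

end NeumannProblem

/-! ### The Sobolev space with its traces -/

namespace NeumannProblem

/-- The Hilbert space `L²(D) × L²(D; ℝ^N) × L²(∂D)`, in which a function of `H¹(D)` is represented
by the triple of itself, its gradient and its trace. -/
abbrev TripleSpace {N : ℕ} (D : Set (Euc N)) : Type :=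
  WithLp 2 (Lp ℝ 2 (volume.restrict D) ×
    WithLp 2 (Lp (Euc N) 2 (volume.restrict D) × Lp ℝ 2 (surfaceMeasure D)))

variable {N : ℕ} {D : Set (Euc N)}

/-- The triple represents the restriction of the function `φ` to the closure of `D`. -/
def Represents (U : TripleSpace D) (φ : Euc N → ℝ) : Prop :=
  U.fst =ᵐ[volume.restrict D] φ ∧ U.snd.fst =ᵐ[volume.restrict D] ∇ φ ∧
    U.snd.snd =ᵐ[surfaceMeasure D] φ

variable (D) in
/-- The triples that represent restrictions of smooth functions on `ℝ^N`. -/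
noncomputable def smoothTriples : Submodule ℝ (TripleSpace D) where
  carrier := {U | ∃ φ : Euc N → ℝ, ContDiff ℝ ∞ φ ∧ Represents U φ}
  zero_mem' := by
    refine ⟨fun _ => 0, contDiff_const, Lp.coeFn_zero _ _ _, ?_, Lp.coeFn_zero _ _ _⟩
    have h : ∇ (fun _ : Euc N => (0 : ℝ)) = 0 := by
      ext1 x
      simp [gradient]
    rw [h]
    exact Lp.coeFn_zero _ _ _
  add_mem' := by
    rintro U V ⟨φ, hφ, h1, h2, h3⟩ ⟨χ, hχ, k1, k2, k3⟩
    refine ⟨φ + χ, hφ.add hχ, (Lp.coeFn_add _ _).trans (h1.add k1), ?_,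
      (Lp.coeFn_add _ _).trans (h3.add k3)⟩
    have h : ∇ (φ + χ) = ∇ φ + ∇ χ := by
      ext1 x
      simp only [gradient, Pi.add_apply]
      rw [fderiv_add (hφ.differentiable (by simp) x) (hχ.differentiable (by simp) x), map_add]
    rw [h]
    exact (Lp.coeFn_add _ _).trans (h2.add k2)
  smul_mem' := by
    rintro c U ⟨φ, hφ, h1, h2, h3⟩
    refine ⟨c • φ, hφ.const_smul c, (Lp.coeFn_smul _ _).trans (h1.const_smul c), ?_,
      (Lp.coeFn_smul _ _).trans (h3.const_smul c)⟩
    have h : ∇ (c • φ) = c • ∇ φ := by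
      ext1 x
      simp only [gradient, Pi.smul_apply]
      rw [fderiv_const_smul (hφ.differentiable (by simp) x)]
      simp
    rw [h]
    exact (Lp.coeFn_smul _ _).trans (h2.const_smul c)

variable (D) in
/-- The closure of the smooth triples: the triples of a function in `H¹(D)`, its gradient and its
trace. -/
noncomputable def sobolevTriples : Submodule ℝ (TripleSpace D) :=
  (smoothTriples D).topologicalClosure

theorem isClosed_sobolevTriples : IsClosed (sobolevTriples D : Set (TripleSpace D)) :=
  Submodule.isClosed_topologicalClosure _

instance : CompleteSpace (sobolevTriples D) := isClosed_sobolevTriples.completeSpace_coe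

/-- A closed condition that holds for smooth triples holds for Sobolev triples. -/
theorem sobolevTriples_induction {p : TripleSpace D → Prop} (hp : IsClosed {U | p U})
    (h : ∀ U φ, ContDiff ℝ ∞ φ → Represents U φ → p U) {U : TripleSpace D}
    (hU : U ∈ sobolevTriples D) : p U := by
  have h1 : (smoothTriples D : Set (TripleSpace D)) ⊆ {U | p U} := by
    rintro U ⟨φ, hφ, hUφ⟩
    exact h U φ hφ hUφ
  exact closure_minimal h1 hp hU

theorem continuous_triple_fst : Continuous fun U : TripleSpace D => U.fst :=
  (WithLp.fstL 2 ℝ _ _).continuous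

theorem continuous_triple_snd_fst : Continuous fun U : TripleSpace D => U.snd.fst :=
  (WithLp.fstL 2 ℝ _ _).continuous.comp (WithLp.sndL 2 ℝ _ _).continuous

theorem continuous_triple_snd_snd : Continuous fun U : TripleSpace D => U.snd.snd :=
  (WithLp.sndL 2 ℝ _ _).continuous.comp (WithLp.sndL 2 ℝ _ _).continuous

theorem norm_sq_triple (U : TripleSpace D) :
    ‖U‖ ^ 2 = ‖U.fst‖ ^ 2 + (‖U.snd.fst‖ ^ 2 + ‖U.snd.snd‖ ^ 2) := by
  rw [WithLp.prod_norm_sq_eq_of_L2, WithLp.prod_norm_sq_eq_of_L2]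

theorem inner_triple (U V : TripleSpace D) :
    inner ℝ U V = inner ℝ U.fst V.fst +
      (inner ℝ U.snd.fst V.snd.fst + inner ℝ U.snd.snd V.snd.snd) := rfl

theorem _root_.MeasureTheory.Lp.norm_sq_eq_integral {Ω F : Type*} [MeasurableSpace Ω]
    {μ : Measure Ω}    [NormedAddCommGroup F] [InnerProductSpace ℝ F] (f : Lp F 2 μ) :
    ‖f‖ ^ 2 = ∫ x, ‖f x‖ ^ 2 ∂μ := by
  rw [← real_inner_self_eq_norm_sq, L2.inner_def]
  simp only [real_inner_self_eq_norm_sq]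

theorem _root_.MeasureTheory.Lp.ofReal_norm_sq {α F : Type*} [MeasurableSpace α] {μ : Measure α}
    [NormedAddCommGroup F] [InnerProductSpace ℝ F] (f : Lp F 2 μ) :
    ENNReal.ofReal (‖f‖ ^ 2) = ∫⁻ x, ENNReal.ofReal (‖f x‖ ^ 2) ∂μ := by
  rw [Lp.norm_sq_eq_integral]
  exact ofReal_integral_eq_lintegral_ofReal ((Lp.memLp f).integrable_norm_pow (by simp))
    (ae_of_all _ fun x => by positivity)

theorem _root_.Continuous.memLp_of_ae_mem_isCompact {X F : Type*} [TopologicalSpace X]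
    [MeasurableSpace X] [OpensMeasurableSpace X] [SecondCountableTopology X]
    [NormedAddCommGroup F] {μ : Measure X}
    [IsFiniteMeasure μ] {f : X → F} (hf : Continuous f) {K : Set X} (hK : IsCompact K)
    (hμ : ∀ᵐ x ∂μ, x ∈ K) (p : ℝ≥0∞) : MemLp f p μ := by
  obtain ⟨C, hC⟩ := hK.exists_bound_of_continuousOn hf.continuousOn
  exact MemLp.of_bound hf.aestronglyMeasurable C (hμ.mono fun x hx => hC x hx)

theorem IsSmoothDomain.isFiniteMeasure_restrict (hD : IsSmoothDomain D) :
    IsFiniteMeasure (volume.restrict D) :=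
  ⟨by simpa using hD.isBounded.measure_lt_top⟩

theorem IsSmoothDomain.memLp_restrict (hD : IsSmoothDomain D) {F : Type*} [NormedAddCommGroup F]
    {f : Euc N → F} (hf : Continuous f) : MemLp f 2 (volume.restrict D) := by
  have := hD.isFiniteMeasure_restrict
  exact hf.memLp_of_ae_mem_isCompact hD.isCompact_closure
    ((ae_restrict_mem hD.isOpen.measurableSet).mono fun x hx => subset_closure hx) 2

theorem IsSmoothDomain.memLp_surfaceMeasure (hN : 1 ≤ N) (hD : IsSmoothDomain D) {F : Type*}
    [NormedAddCommGroup F] {f : Euc N → F} (hf : Continuous f) :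
    MemLp f 2 (surfaceMeasure D) := by
  have := hD.isFiniteMeasure_surfaceMeasure hN
  exact hf.memLp_of_ae_mem_isCompact (μ := surfaceMeasure D) hD.isCompact_frontier
    (ae_restrict_mem isClosed_frontier.measurableSet) 2

/-- The triple of three square integrable functions. -/
noncomputable def mkTriple {u : Euc N → ℝ} {G : Euc N → Euc N} {T : Euc N → ℝ}
    (hu : MemLp u 2 (volume.restrict D)) (hG : MemLp G 2 (volume.restrict D))
    (hT : MemLp T 2 (surfaceMeasure D)) : TripleSpace D :=
  WithLp.toLp 2 (hu.toLp u, WithLp.toLp 2 (hG.toLp G, hT.toLp T))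

theorem represents_mkTriple {φ : Euc N → ℝ} (h₁ : MemLp φ 2 (volume.restrict D))
    (h₂ : MemLp (∇ φ) 2 (volume.restrict D)) (h₃ : MemLp φ 2 (surfaceMeasure D)) :
    Represents (mkTriple h₁ h₂ h₃) φ :=
  ⟨h₁.coeFn_toLp, h₂.coeFn_toLp, h₃.coeFn_toLp⟩

theorem IsSmoothDomain.exists_represents (hN : 1 ≤ N) (hD : IsSmoothDomain D) {φ : Euc N → ℝ}
    (hφ : ContDiff ℝ ∞ φ) : ∃ U : TripleSpace D, Represents U φ :=
  ⟨_, represents_mkTriple (hD.memLp_restrict hφ.continuous)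
    (hD.memLp_restrict (continuous_gradient hφ)) (hD.memLp_surfaceMeasure hN hφ.continuous)⟩

/-- The trace inequality on the Sobolev space. -/
theorem IsSmoothDomain.exists_trace_le (hN : 1 ≤ N) (hD : IsSmoothDomain D) {ε : ℝ}
    (hε : 0 < ε) : ∃ C : ℝ, 0 ≤ C ∧ ∀ U ∈ sobolevTriples D,
      ‖U.snd.snd‖ ^ 2 ≤ C * ‖U.fst‖ ^ 2 + ε * ‖U.snd.fst‖ ^ 2 := by
  obtain ⟨C, hC, h⟩ := hD.exists_trace_inequality hN hε
  refine ⟨C, hC, fun U hU => sobolevTriples_induction (p := fun U =>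
    ‖U.snd.snd‖ ^ 2 ≤ C * ‖U.fst‖ ^ 2 + ε * ‖U.snd.fst‖ ^ 2) ?_ ?_ hU⟩
  · have h1 := continuous_triple_fst (D := D)
    have h2 := continuous_triple_snd_fst (D := D)
    have h3 := continuous_triple_snd_snd (D := D)
    exact isClosed_le (by fun_prop) (by fun_prop)
  · rintro U φ hφ ⟨h1, h2, h3⟩
    have hgc := continuous_gradient hφ
    have hφc := hφ.continuous
    rw [← ENNReal.ofReal_le_ofReal_iff (by positivity), ENNReal.ofReal_add (by positivity)
      (by positivity), ENNReal.ofReal_mul hC, ENNReal.ofReal_mul hε.le, Lp.ofReal_norm_sq,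
      Lp.ofReal_norm_sq, Lp.ofReal_norm_sq]
    calc _ = ∫⁻ x, ENNReal.ofReal (φ x ^ 2) ∂(surfaceMeasure D) := by
          refine lintegral_congr_ae (h3.mono fun x hx => ?_)
          simp only [hx, Real.norm_eq_abs, sq_abs]
      _ ≤ _ := h φ hφ
      _ = ∫⁻ x in D, (ENNReal.ofReal C * ENNReal.ofReal (φ x ^ 2) +
            ENNReal.ofReal ε * ENNReal.ofReal (‖∇ φ x‖ ^ 2)) := by
          refine lintegral_congr fun x => ?_
          rw [ENNReal.ofReal_add (by positivity) (by positivity), ENNReal.ofReal_mul hC,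
            ENNReal.ofReal_mul hε.le]
      _ = ENNReal.ofReal C * (∫⁻ x in D, ENNReal.ofReal (φ x ^ 2)) +
            ENNReal.ofReal ε * ∫⁻ x in D, ENNReal.ofReal (‖∇ φ x‖ ^ 2) := by
          rw [lintegral_add_left, lintegral_const_mul' _ _ ENNReal.ofReal_ne_top,
            lintegral_const_mul' _ _ ENNReal.ofReal_ne_top]
          exact (Continuous.measurable (by fun_prop)).ennreal_ofReal.const_mul _
      _ = _ := by
          congr 2
          · refine lintegral_congr_ae (h1.mono fun x hx => ?_)
            simp only [hx, Real.norm_eq_abs, sq_abs]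
          · refine lintegral_congr_ae (h2.mono fun x hx => ?_)
            simp only [hx]

/-- The gradient of a smooth function is its weak gradient, tested in the direction `v`. -/
theorem setIntegral_mul_inner_gradient {φ χ : Euc N → ℝ} (hφ : ContDiff ℝ ∞ φ)
    (hχ : ContDiff ℝ ∞ χ) (hχc : HasCompactSupport χ) (hχD : tsupport χ ⊆ D) (v : Euc N) :
    ∫ x in D, φ x * inner ℝ (∇ χ x) v = - ∫ x in D, χ x * inner ℝ (∇ φ x) v := by
  have hχ0 : ∀ x, x ∉ D → χ x = 0 := fun x hx =>
    image_eq_zero_of_notMem_tsupport fun h => hx (hχD h)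
  have hχ0' : ∀ x, x ∉ D → fderiv ℝ χ x v = 0 := by
    intro x hx
    have : fderiv ℝ χ x = 0 := by
      by_contra hne
      exact hx (hχD (support_fderiv_subset ℝ hne))
    rw [this]; rfl
  simp only [inner_gradient_left]
  rw [setIntegral_eq_integral_of_forall_compl_eq_zero fun x hx => by rw [hχ0' x hx, mul_zero],
    setIntegral_eq_integral_of_forall_compl_eq_zero fun x hx => by rw [hχ0 x hx, zero_mul]]
  have hφ' : Continuous fun x => fderiv ℝ φ x v :=
    (hφ.continuous_fderiv (by simp)).clm_apply continuous_const
  have hχ' : Continuous fun x => fderiv ℝ χ x v :=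
    (hχ.continuous_fderiv (by simp)).clm_apply continuous_const
  have hχ'c : HasCompactSupport fun x => fderiv ℝ χ x v :=
    hχc.fderiv_apply ℝ v
  rw [integral_mul_fderiv_eq_neg_fderiv_mul_of_integrable]
  · simp only [mul_comm]
  · exact (hφ'.mul hχ.continuous).integrable_of_hasCompactSupport hχc.mul_left
  · exact (hφ.continuous.mul hχ').integrable_of_hasCompactSupport hχ'c.mul_left
  · exact (hφ.continuous.mul hχ.continuous).integrable_of_hasCompactSupport hχc.mul_left
  · exact fun x _ => hφ.differentiable (by simp) x
  · exact fun x _ => hχ.differentiable (by simp) x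

/-- The gradient component of a Sobolev triple is the weak gradient, since integration by parts
against a test function passes to limits in `L²`. -/
theorem IsSmoothDomain.memH1With_of_mem_sobolevTriples (hD : IsSmoothDomain D)
    {U : TripleSpace D} (hU : U ∈ sobolevTriples D) : MemH1With D U.fst U.snd.fst := by
  refine ⟨Lp.memLp _, Lp.memLp _, fun χ hχ hχc hχD => ?_⟩
  have hgm : MemLp (∇ χ) 2 (volume.restrict D) := hD.memLp_restrict (continuous_gradient hχ)
  have hm : MemLp χ 2 (volume.restrict D) := hD.memLp_restrict hχ.continuous
  have hi1 : Integrable (fun x => (U.fst x : ℝ) • ∇ χ x) (volume.restrict D) :=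
    memLp_one_iff_integrable.1 (hgm.smul (Lp.memLp U.fst))
  have hi2 : Integrable (fun x => χ x • U.snd.fst x) (volume.restrict D) :=
    memLp_one_iff_integrable.1 ((Lp.memLp U.snd.fst).smul hm)
  refine ext_inner_left ℝ fun v => ?_
  rw [inner_neg_right, ← integral_inner hi1, ← integral_inner hi2]
  have hv1 : MemLp (fun x => inner ℝ (∇ χ x) v) 2 (volume.restrict D) := hgm.inner_const v
  have hv2 : MemLp (fun x => χ x • v) 2 (volume.restrict D) :=
    hD.memLp_restrict (hχ.continuous.smul continuous_const)
  -- in this form the identity is visibly closed in `U`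
  have key : inner ℝ U.fst (hv1.toLp _) = -inner ℝ (hv2.toLp _) U.snd.fst := by
    refine sobolevTriples_induction (p := fun U : TripleSpace D =>
      inner ℝ U.fst (hv1.toLp _) = -inner ℝ (hv2.toLp _) U.snd.fst) ?_ ?_ hU
    · exact isClosed_eq (continuous_triple_fst.inner continuous_const)
        (continuous_const.inner continuous_triple_snd_fst).neg
    · rintro V φ hφ ⟨h1, h2, -⟩
      rw [L2.inner_def, L2.inner_def]
      calc _ = ∫ x in D, φ x * inner ℝ (∇ χ x) v := by
            refine integral_congr_ae ?_
            filter_upwards [h1, hv1.coeFn_toLp] with x hx1 hx2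
            rw [hx1, hx2, real_inner_comm]
            exact real_inner_eq_re_inner ℝ _ _
        _ = - ∫ x in D, χ x * inner ℝ (∇ φ x) v :=
            setIntegral_mul_inner_gradient hφ hχ hχc hχD v
        _ = _ := by
            congr 1
            refine integral_congr_ae ?_
            filter_upwards [h2, hv2.coeFn_toLp] with x hx1 hx2
            rw [hx1, hx2, real_inner_smul_left, real_inner_comm]
  rw [L2.inner_def, L2.inner_def] at key
  calc _ = ∫ x in D, inner ℝ (U.fst x) ((hv1.toLp _ : Lp ℝ 2 (volume.restrict D)) x) := by
        refine integral_congr_ae ?_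
        filter_upwards [hv1.coeFn_toLp] with x hx
        rw [hx, real_inner_smul_right, real_inner_comm v]
        simp [mul_comm]
    _ = _ := key
    _ = _ := by
        congr 1
        refine integral_congr_ae ?_
        filter_upwards [hv2.coeFn_toLp] with x hx
        rw [hx, real_inner_smul_left, real_inner_smul_right]

theorem isTrace_of_mem_sobolevTriples {U : TripleSpace D} (hU : U ∈ sobolevTriples D) :
    IsTrace D U.fst U.snd.fst U.snd.snd := by
  refine ⟨Lp.memLp _, ?_⟩
  obtain ⟨V, hV, hVU⟩ := mem_closure_iff_seq_limit.1 hU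
  choose φ hφ hVφ using hV
  refine ⟨φ, hφ, ?_, ?_, ?_⟩
  · have h := (Lp.tendsto_Lp_iff_tendsto_eLpNorm' _ _).1
      ((continuous_triple_fst.tendsto U).comp hVU)
    exact h.congr fun n => eLpNorm_congr_ae ((hVφ n).1.sub EventuallyEq.rfl)
  · have h := (Lp.tendsto_Lp_iff_tendsto_eLpNorm' _ _).1
      ((continuous_triple_snd_fst.tendsto U).comp hVU)
    exact h.congr fun n => eLpNorm_congr_ae ((hVφ n).2.1.sub EventuallyEq.rfl)
  · have h := (Lp.tendsto_Lp_iff_tendsto_eLpNorm' _ _).1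
      ((continuous_triple_snd_snd.tendsto U).comp hVU)
    exact h.congr fun n => eLpNorm_congr_ae ((hVφ n).2.2.sub EventuallyEq.rfl)

/-- A function that has a trace is a Sobolev triple: the sequence in the definition of the trace
is one of smooth triples. -/
theorem IsTrace.mkTriple_mem_sobolevTriples (hN : 1 ≤ N) (hD : IsSmoothDomain D)
    {u : Euc N → ℝ} {G : Euc N → Euc N} {T : Euc N → ℝ} (hu : MemLp u 2 (volume.restrict D))
    (hG : MemLp G 2 (volume.restrict D)) (hT : IsTrace D u G T) :
    mkTriple hu hG hT.1 ∈ sobolevTriples D := by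
  obtain ⟨hTm, φ, hφ, h1, h2, h3⟩ := hT
  have m1 := fun n => hD.memLp_restrict (hφ n).continuous
  have m2 := fun n => hD.memLp_restrict (continuous_gradient (hφ n))
  have m3 := fun n => hD.memLp_surfaceMeasure hN (hφ n).continuous
  refine mem_closure_of_tendsto (f := fun n => mkTriple (m1 n) (m2 n) (m3 n)) (b := atTop) ?_
    (Eventually.of_forall fun n => ⟨φ n, hφ n, represents_mkTriple (m1 n) (m2 n) (m3 n)⟩)
  have t1 := (Lp.tendsto_Lp_iff_tendsto_eLpNorm'' φ m1 u hu).2 h1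
  have t2 := (Lp.tendsto_Lp_iff_tendsto_eLpNorm'' (fun n => ∇ (φ n)) m2 G hG).2 h2
  have t3 := (Lp.tendsto_Lp_iff_tendsto_eLpNorm'' φ m3 T hTm).2 h3
  exact ((WithLp.prod_continuous_toLp 2 _ _).tendsto _).comp (t1.prodMk_nhds
    (((WithLp.prod_continuous_toLp 2 _ _).tendsto _).comp (t2.prodMk_nhds t3)))

end NeumannProblem

/-! ### Superposition operators on `L²` -/

section Superposition

variable {Ω Y F : Type*} [MeasurableSpace Ω] {μ : Measure Ω}
  [NormedAddCommGroup Y] [MeasurableSpace Y] [NormedAddCommGroup F] [MeasurableSpace F]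

/-- A Carathéodory function of linear growth: jointly measurable and, for almost every `x`,
continuous in the second variable with `‖Φ x y‖ ≤ M * (1 + ‖y‖)`. -/
structure IsCaratheodory (μ : Measure Ω) (Φ : Ω → Y → F) (M : ℝ) : Prop where
  measurable : Measurable fun p : Ω × Y => Φ p.1 p.2
  ae_continuous : ∀ᵐ x ∂μ, Continuous (Φ x)
  ae_growth : ∀ᵐ x ∂μ, ∀ y, ‖Φ x y‖ ≤ M * (1 + ‖y‖)

namespace IsCaratheodory

variable {Φ Ψ : Ω → Y → F} {M M' : ℝ}

theorem add [BorelSpace F] [SecondCountableTopology F] (hΦ : IsCaratheodory μ Φ M)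
    (hΨ : IsCaratheodory μ Ψ M') :
    IsCaratheodory μ (fun x y => Φ x y + Ψ x y) (M + M') where
  measurable := hΦ.measurable.add hΨ.measurable
  ae_continuous := by
    filter_upwards [hΦ.ae_continuous, hΨ.ae_continuous] with x h1 h2 using h1.add h2
  ae_growth := by
    filter_upwards [hΦ.ae_growth, hΨ.ae_growth] with x h1 h2 y
    rw [add_mul]
    exact (norm_add_le _ _).trans (add_le_add (h1 y) (h2 y))

theorem const_smul [NormedSpace ℝ F] [BorelSpace F] (hΦ : IsCaratheodory μ Φ M) (c : ℝ) :
    IsCaratheodory μ (fun x y => c • Φ x y) (|c| * M) where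
  measurable := hΦ.measurable.const_smul c
  ae_continuous := hΦ.ae_continuous.mono fun x h => h.const_smul c
  ae_growth := hΦ.ae_growth.mono fun x h y => by
    rw [norm_smul, Real.norm_eq_abs, mul_assoc]
    exact mul_le_mul_of_nonneg_left (h y) (abs_nonneg c)

variable [BorelSpace Y] [BorelSpace F] [SecondCountableTopology F] [IsFiniteMeasure μ]
  {w v : Ω → Y}

theorem memLp (hΦ : IsCaratheodory μ Φ M) (hw : MemLp w 2 μ) :
    MemLp (fun x => Φ x (w x)) 2 μ := by
  have hm : AEStronglyMeasurable (fun x => Φ x (w x)) μ :=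
    (hΦ.measurable.comp_aemeasurable
      (aemeasurable_id.prodMk hw.aestronglyMeasurable.aemeasurable)).aestronglyMeasurable
  have hg : MemLp (fun x => 1 + ‖w x‖) 2 μ := (memLp_const (1 : ℝ)).add hw.norm
  refine hg.of_le_mul (c := M) hm (hΦ.ae_growth.mono fun x hx => ?_)
  rw [Real.norm_eq_abs, abs_of_nonneg (by positivity)]
  exact hx (w x)

theorem integrable_inner [InnerProductSpace ℝ F] (hΦ : IsCaratheodory μ Φ M) (hw : MemLp w 2 μ)
    {g : Ω → F} (hg : MemLp g 2 μ) : Integrable (fun x => inner ℝ (Φ x (w x)) (g x)) μ :=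
  ((hΦ.memLp hw).norm.integrable_mul hg.norm).mono'
    ((hΦ.memLp hw).aestronglyMeasurable.inner hg.aestronglyMeasurable)
    (ae_of_all _ fun _ => norm_inner_le_norm _ _)

/-- Superposition by a Carathéodory function is weakly continuous along lines. -/
theorem tendsto_integral_inner [NormedSpace ℝ Y] [InnerProductSpace ℝ F] (hΦ : IsCaratheodory μ Φ M)
    (hw : MemLp w 2 μ) (hv : MemLp v 2 μ) {g : Ω → F} (hg : MemLp g 2 μ) :
    Tendsto (fun t : ℝ => ∫ x, inner ℝ (Φ x (w x + t • v x)) (g x) ∂μ) (𝓝[>] 0)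
      (𝓝 (∫ x, inner ℝ (Φ x (w x)) (g x) ∂μ)) := by
  refine tendsto_integral_filter_of_dominated_convergence
    (fun x => |M| * (1 + (‖w x‖ + ‖v x‖)) * ‖g x‖) ?_ ?_ ?_ ?_
  · exact Eventually.of_forall fun t =>
      (hΦ.integrable_inner (hw.add (hv.const_smul t)) hg).aestronglyMeasurable
  · have h01 : ∀ᶠ t : ℝ in 𝓝[>] 0, t ∈ Ioo (0 : ℝ) 1 := Ioo_mem_nhdsGT one_pos
    filter_upwards [h01] with t ht
    filter_upwards [hΦ.ae_growth] with x hx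
    have h1 : ‖w x + t • v x‖ ≤ ‖w x‖ + ‖v x‖ := by
      refine (norm_add_le _ _).trans (add_le_add le_rfl ?_)
      rw [norm_smul, Real.norm_eq_abs, abs_of_pos ht.1]
      exact mul_le_of_le_one_left (norm_nonneg _) ht.2.le
    calc ‖inner ℝ (Φ x (w x + t • v x)) (g x)‖
        ≤ ‖Φ x (w x + t • v x)‖ * ‖g x‖ := norm_inner_le_norm _ _
      _ ≤ M * (1 + ‖w x + t • v x‖) * ‖g x‖ := by gcongr; exact hx _
      _ ≤ |M| * (1 + ‖w x + t • v x‖) * ‖g x‖ := by gcongr; exact le_abs_self M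
      _ ≤ |M| * (1 + (‖w x‖ + ‖v x‖)) * ‖g x‖ := by gcongr
  · have h2 : MemLp (fun x => |M| * (1 + (‖w x‖ + ‖v x‖))) 2 μ :=
      ((memLp_const (1 : ℝ)).add (hw.norm.add hv.norm)).const_mul _
    exact h2.integrable_mul hg.norm
  · filter_upwards [hΦ.ae_continuous] with x hx
    have h3 : Continuous fun t : ℝ => inner ℝ (Φ x (w x + t • v x)) (g x) :=
      (hx.comp (by fun_prop)).inner continuous_const
    have h4 := h3.tendsto 0
    simp only [zero_smul, add_zero] at h4
    exact h4.mono_left nhdsWithin_le_nhds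

end IsCaratheodory

open Classical in
/-- The superposition `x ↦ Φ x (w x)` as an element of `L²`, with value `0` if it is not square
integrable. -/
noncomputable def superposition (μ : Measure Ω) (Φ : Ω → Y → F) (w : Ω → Y) : Lp F 2 μ :=
  if h : MemLp (fun x => Φ x (w x)) 2 μ then h.toLp _ else 0

variable [BorelSpace Y] [BorelSpace F] [SecondCountableTopology F] [IsFiniteMeasure μ]
  {Φ : Ω → Y → F} {M : ℝ} {w : Ω → Y}

theorem coeFn_superposition (hΦ : IsCaratheodory μ Φ M) (hw : MemLp w 2 μ) :
    superposition μ Φ w =ᵐ[μ] fun x => Φ x (w x) := by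
  rw [superposition, dif_pos (hΦ.memLp hw)]
  exact MemLp.coeFn_toLp _

theorem inner_superposition [InnerProductSpace ℝ F] (hΦ : IsCaratheodory μ Φ M) (hw : MemLp w 2 μ)
    {g : Ω → F} {G : Lp F 2 μ} (hG : G =ᵐ[μ] g) :
    inner ℝ (superposition μ Φ w) G = ∫ x, inner ℝ (Φ x (w x)) (g x) ∂μ := by
  rw [L2.inner_def]
  refine integral_congr_ae ?_
  filter_upwards [coeFn_superposition hΦ hw, hG] with x h1 h2
  rw [h1, h2]

end Superposition

theorem MeasureTheory.MemLp.prodMk_two {Ω E F : Type*} [MeasurableSpace Ω] {μ : Measure Ω}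
    [NormedAddCommGroup E] [NormedAddCommGroup F] {u : Ω → E} {v : Ω → F} (hu : MemLp u 2 μ)
    (hv : MemLp v 2 μ) : MemLp (fun x => (u x, v x)) 2 μ := by
  refine (hu.norm.add hv.norm).of_le (hu.aestronglyMeasurable.prodMk hv.aestronglyMeasurable)
    (ae_of_all _ fun x => ?_)
  rw [Pi.add_apply, Real.norm_eq_abs, abs_of_nonneg (by positivity), Prod.norm_def]
  exact max_le (le_add_of_nonneg_right (norm_nonneg _)) (le_add_of_nonneg_left (norm_nonneg _))

/-! ### The operator of the boundary value problem -/

namespace NeumannProblem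

variable {N : ℕ} {D : Set (Euc N)} {Φ₁ : Euc N → ℝ × Euc N → ℝ} {Φ₂ : Euc N → ℝ × Euc N → Euc N}
  {Φ₃ : Euc N → ℝ → ℝ} {M₁ M₂ M₃ : ℝ}

/-- The function together with its gradient. -/
noncomputable def jet (U : TripleSpace D) (x : Euc N) : ℝ × Euc N := (U.fst x, U.snd.fst x)

theorem memLp_jet (U : TripleSpace D) : MemLp (jet U) 2 (volume.restrict D) :=
  (Lp.memLp U.fst).prodMk_two (Lp.memLp U.snd.fst)

/-- The operator whose pairing with the triple of `φ` is
`∫_D Φ₁(x, u, ∇u) φ + ∫_D ⟪Φ₂(x, u, ∇u), ∇φ⟫ + ∫_{∂D} Φ₃(x, Tr u) φ`. -/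
noncomputable def tripleOp (Φ₁ : Euc N → ℝ × Euc N → ℝ) (Φ₂ : Euc N → ℝ × Euc N → Euc N)
    (Φ₃ : Euc N → ℝ → ℝ) (U : TripleSpace D) : TripleSpace D :=
  WithLp.toLp 2 (superposition (volume.restrict D) Φ₁ (jet U),
    WithLp.toLp 2 (superposition (volume.restrict D) Φ₂ (jet U),
      superposition (surfaceMeasure D) Φ₃ U.snd.snd))

variable [IsFiniteMeasure (volume.restrict D)] [IsFiniteMeasure (surfaceMeasure D)]
  (h₁ : IsCaratheodory (volume.restrict D) Φ₁ M₁) (h₂ : IsCaratheodory (volume.restrict D) Φ₂ M₂)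
  (h₃ : IsCaratheodory (surfaceMeasure D) Φ₃ M₃)

include h₁ h₂ h₃

theorem inner_tripleOp (U V : TripleSpace D) :
    inner ℝ (tripleOp Φ₁ Φ₂ Φ₃ U) V =
      (∫ x in D, inner ℝ (Φ₁ x (jet U x)) (V.fst x)) +
      ((∫ x in D, inner ℝ (Φ₂ x (jet U x)) (V.snd.fst x)) +
        ∫ x, inner ℝ (Φ₃ x (U.snd.snd x)) (V.snd.snd x) ∂(surfaceMeasure D)) := by
  rw [← inner_superposition h₁ (memLp_jet U) EventuallyEq.rfl,
    ← inner_superposition h₂ (memLp_jet U) EventuallyEq.rfl,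
    ← inner_superposition h₃ (Lp.memLp U.snd.snd) EventuallyEq.rfl]
  rfl

theorem tendsto_inner_tripleOp (U V : TripleSpace D) :
    Tendsto (fun t : ℝ => inner ℝ (tripleOp Φ₁ Φ₂ Φ₃ (U + t • V)) V) (𝓝[>] 0)
      (𝓝 (inner ℝ (tripleOp Φ₁ Φ₂ Φ₃ U) V)) := by
  have hjet : ∀ t : ℝ, jet (U + t • V) =ᵐ[volume.restrict D] fun x => jet U x + t • jet V x := by
    intro t
    have e1 := Lp.coeFn_add U.fst (t • V.fst)
    have e2 := Lp.coeFn_smul t V.fst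
    have e3 := Lp.coeFn_add U.snd.fst (t • V.snd.fst)
    have e4 := Lp.coeFn_smul t V.snd.fst
    filter_upwards [e1, e2, e3, e4] with x x1 x2 x3 x4
    rw [Pi.add_apply, x2, Pi.smul_apply] at x1
    rw [Pi.add_apply, x4, Pi.smul_apply] at x3
    exact Prod.ext x1 x3
  have htr : ∀ t : ℝ, (U + t • V).snd.snd =ᵐ[surfaceMeasure D]
      fun x => U.snd.snd x + t • V.snd.snd x := by
    intro t
    have e1 := Lp.coeFn_add U.snd.snd (t • V.snd.snd)
    have e2 := Lp.coeFn_smul t V.snd.snd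
    filter_upwards [e1, e2] with x x1 x2
    rw [Pi.add_apply, x2, Pi.smul_apply] at x1
    exact x1
  simp only [inner_tripleOp h₁ h₂ h₃]
  refine Tendsto.add ?_ (Tendsto.add ?_ ?_)
  · refine (h₁.tendsto_integral_inner (memLp_jet U) (memLp_jet V) (Lp.memLp V.fst)).congr
      fun t => integral_congr_ae ((hjet t).mono fun x hx => ?_)
    simp only [hx]
  · refine (h₂.tendsto_integral_inner (memLp_jet U) (memLp_jet V) (Lp.memLp V.snd.fst)).congr
      fun t => integral_congr_ae ((hjet t).mono fun x hx => ?_)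
    simp only [hx]
  · refine (h₃.tendsto_integral_inner (Lp.memLp U.snd.snd) (Lp.memLp V.snd.snd)
      (Lp.memLp V.snd.snd)).congr fun t => integral_congr_ae ((htr t).mono fun x hx => ?_)
    simp only [hx]

/-- Pointwise monotonicity of the coefficients, integrated. -/
theorem le_inner_tripleOp_sub {a m κ : ℝ}
    (hmono : ∀ᵐ x ∂(volume.restrict D), ∀ p p' : ℝ × Euc N,
      m * (p.1 - p'.1) ^ 2 + a * ‖p.2 - p'.2‖ ^ 2 ≤
        (Φ₁ x p - Φ₁ x p') * (p.1 - p'.1) + inner ℝ (Φ₂ x p - Φ₂ x p') (p.2 - p'.2))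
    (hmono' : ∀ᵐ x ∂(surfaceMeasure D), ∀ y y' : ℝ,
      -κ * (y - y') ^ 2 ≤ (Φ₃ x y - Φ₃ x y') * (y - y'))
    (U V : TripleSpace D) :
    m * ‖U.fst - V.fst‖ ^ 2 + a * ‖U.snd.fst - V.snd.fst‖ ^ 2 - κ * ‖U.snd.snd - V.snd.snd‖ ^ 2 ≤
      inner ℝ (tripleOp Φ₁ Φ₂ Φ₃ U - tripleOp Φ₁ Φ₂ Φ₃ V) (U - V) := by
  have e1 := Lp.coeFn_sub U.fst V.fst
  have e2 := Lp.coeFn_sub U.snd.fst V.snd.fst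
  have e3 := Lp.coeFn_sub U.snd.snd V.snd.snd
  set W : TripleSpace D := U - V with hW
  change m * ‖W.fst‖ ^ 2 + a * ‖W.snd.fst‖ ^ 2 - κ * ‖W.snd.snd‖ ^ 2 ≤ _
  change W.fst =ᵐ[_] _ at e1
  change W.snd.fst =ᵐ[_] _ at e2
  change W.snd.snd =ᵐ[_] _ at e3
  have i1 : ∀ Z : TripleSpace D, Integrable
      (fun x => inner ℝ (Φ₁ x (jet Z x)) (W.fst x)) (volume.restrict D) :=
    fun Z => h₁.integrable_inner (memLp_jet Z) (Lp.memLp _)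
  have i2 : ∀ Z : TripleSpace D, Integrable
      (fun x => inner ℝ (Φ₂ x (jet Z x)) (W.snd.fst x)) (volume.restrict D) :=
    fun Z => h₂.integrable_inner (memLp_jet Z) (Lp.memLp _)
  have i3 : ∀ Z : TripleSpace D, Integrable
      (fun x => inner ℝ (Φ₃ x (Z.snd.snd x)) (W.snd.snd x)) (surfaceMeasure D) :=
    fun Z => h₃.integrable_inner (Lp.memLp _) (Lp.memLp _)
  have n1 : Integrable (fun x => ‖W.fst x‖ ^ 2) (volume.restrict D) :=
    (Lp.memLp W.fst).integrable_norm_pow (by simp)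
  have n2 : Integrable (fun x => ‖W.snd.fst x‖ ^ 2) (volume.restrict D) :=
    (Lp.memLp W.snd.fst).integrable_norm_pow (by simp)
  have n3 : Integrable (fun x => ‖W.snd.snd x‖ ^ 2) (surfaceMeasure D) :=
    (Lp.memLp W.snd.snd).integrable_norm_pow (by simp)
  have j1 : Integrable (fun x => inner ℝ (Φ₁ x (jet U x)) (W.fst x) -
      inner ℝ (Φ₁ x (jet V x)) (W.fst x)) (volume.restrict D) := (i1 U).sub (i1 V)
  have j2 : Integrable (fun x => inner ℝ (Φ₂ x (jet U x)) (W.snd.fst x) -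
      inner ℝ (Φ₂ x (jet V x)) (W.snd.fst x)) (volume.restrict D) := (i2 U).sub (i2 V)
  have hin : m * ‖W.fst‖ ^ 2 + a * ‖W.snd.fst‖ ^ 2 ≤
      ((∫ x in D, inner ℝ (Φ₁ x (jet U x)) (W.fst x)) -
        ∫ x in D, inner ℝ (Φ₁ x (jet V x)) (W.fst x)) +
      ((∫ x in D, inner ℝ (Φ₂ x (jet U x)) (W.snd.fst x)) -
        ∫ x in D, inner ℝ (Φ₂ x (jet V x)) (W.snd.fst x)) := by
    rw [← integral_sub (i1 U) (i1 V), ← integral_sub (i2 U) (i2 V),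
      ← integral_add j1 j2, Lp.norm_sq_eq_integral,
      Lp.norm_sq_eq_integral, ← integral_const_mul, ← integral_const_mul,
      ← integral_add (n1.const_mul m) (n2.const_mul a)]
    refine integral_mono_ae ((n1.const_mul m).add (n2.const_mul a))
      (j1.add j2) ?_
    filter_upwards [hmono, e1, e2] with x hx x1 x2
    have h := hx (jet U x) (jet V x)
    simp only [x1, x2, Pi.sub_apply]
    rw [← inner_sub_left, ← inner_sub_left, Real.norm_eq_abs, sq_abs]
    refine h.trans (le_of_eq ?_)
    congr 1
    exact mul_comm _ _
  have hbd : -κ * ‖W.snd.snd‖ ^ 2 ≤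
      (∫ x, inner ℝ (Φ₃ x (U.snd.snd x)) (W.snd.snd x) ∂(surfaceMeasure D)) -
        ∫ x, inner ℝ (Φ₃ x (V.snd.snd x)) (W.snd.snd x) ∂(surfaceMeasure D) := by
    rw [← integral_sub (i3 U) (i3 V), Lp.norm_sq_eq_integral, ← integral_const_mul]
    refine integral_mono_ae (n3.const_mul _) ((i3 U).sub (i3 V)) ?_
    filter_upwards [hmono', e3] with x hx x3
    have h := hx (U.snd.snd x) (V.snd.snd x)
    simp only [x3, Pi.sub_apply]
    rw [← inner_sub_left, Real.norm_eq_abs, sq_abs]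
    exact h.trans (le_of_eq (mul_comm _ _))
  rw [inner_sub_left, inner_tripleOp h₁ h₂ h₃, inner_tripleOp h₁ h₂ h₃]
  linarith

end NeumannProblem

/-! ### Existence and uniqueness for the Neumann problem -/

namespace NeumannProblem

variable {N : ℕ} {D : Set (Euc N)}

/-- The zeroth order coefficient `-(f(x, y, z) + ⟪b x, z⟫ + q x * y)` of the weak equation, as a
function of `x` and the jet `(y, z)`. -/
noncomputable def lowerCoeff (b : Euc N → Euc N) (q : Euc N → ℝ) (f : Euc N → ℝ → Euc N → ℝ)
    (x : Euc N) (p : ℝ × Euc N) : ℝ :=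
  (-1 : ℝ) • (f x p.1 p.2 + (inner ℝ (b x) p.2 + q x * p.1))

/-- The flux `z / 2 - g(x, y, z)`, which is paired with the gradient of the test function. -/
noncomputable def fluxCoeff (g : Euc N → ℝ → Euc N → Euc N) (x : Euc N) (p : ℝ × Euc N) : Euc N :=
  (1 / 2 : ℝ) • p.2 + (-1 : ℝ) • g x p.1 p.2

/-- The boundary coefficient `-(s / 2) * h(x, y)`. -/
noncomputable def boundaryCoeff (s : ℝ) (h : Euc N → ℝ → ℝ) (x : Euc N) (y : ℝ) : ℝ :=
  (-(s / 2)) • h x y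

/-- The data of the problem are Carathéodory functions of linear growth. -/
structure IsAdmissible (D : Set (Euc N)) (b : Euc N → Euc N) (q : Euc N → ℝ)
    (f : Euc N → ℝ → Euc N → ℝ) (h : Euc N → ℝ → ℝ) (g : Euc N → ℝ → Euc N → Euc N)
    (Cb Cq Cf Ch Cg : ℝ) : Prop where
  drift : IsCaratheodory (volume.restrict D) (fun x (p : ℝ × Euc N) => inner ℝ (b x) p.2) Cb
  potential : IsCaratheodory (volume.restrict D) (fun x (p : ℝ × Euc N) => q x * p.1) Cq
  source : IsCaratheodory (volume.restrict D) (fun x (p : ℝ × Euc N) => f x p.1 p.2) Cf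
  boundary : IsCaratheodory (surfaceMeasure D) h Ch
  flux : IsCaratheodory (volume.restrict D) (fun x (p : ℝ × Euc N) => g x p.1 p.2) Cg

theorem isCaratheodory_snd {μ : Measure (Euc N)} :
    IsCaratheodory μ (fun _ (p : ℝ × Euc N) => p.2) 1 where
  measurable := measurable_snd.snd
  ae_continuous := ae_of_all _ fun _ => continuous_snd
  ae_growth := ae_of_all _ fun _ p => by
    have := norm_snd_le p
    linarith

/-- The only point that is not immediate is the joint continuity of `f(x, ·, ·)`, which is
continuous in `y` and Lipschitz in `z`. -/
theorem Conditions.isAdmissible (hDm : MeasurableSet D) {α β K M k β' B C : ℝ} {b : Euc N → Euc N}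
    {q : Euc N → ℝ} {f : Euc N → ℝ → Euc N → ℝ} {h : Euc N → ℝ → ℝ}
    {g : Euc N → ℝ → Euc N → Euc N} (hc : Conditions D α β K M k β' f h g)
    (hb : Continuous b) (hbB : ∀ x, ‖b x‖ ≤ B) (hq : Measurable q) (hqC : ∀ x ∈ D, |q x| ≤ C) :
    IsAdmissible D b q f h g B C (2 * M) M M where
  drift :=
    { measurable := (hb.measurable.comp measurable_fst).inner (measurable_snd.snd)
      ae_continuous := ae_of_all _ fun x => continuous_const.inner continuous_snd
      ae_growth := ae_of_all _ fun x p => by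
        have hB : 0 ≤ B := (norm_nonneg _).trans (hbB x)
        calc ‖inner ℝ (b x) p.2‖ ≤ ‖b x‖ * ‖p.2‖ := norm_inner_le_norm _ _
          _ ≤ B * (1 + ‖p‖) := by
            gcongr
            · exact hbB x
            · linarith [norm_snd_le p] }
  potential :=
    { measurable := (hq.comp measurable_fst).mul measurable_snd.fst
      ae_continuous := ae_of_all _ fun x => continuous_const.mul continuous_fst
      ae_growth := by
        filter_upwards [ae_restrict_mem hDm] with x hx p
        have hC : 0 ≤ C := (abs_nonneg _).trans (hqC x hx)
        rw [norm_mul]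
        gcongr
        · exact hqC x hx
        · linarith [norm_fst_le p] }
  source :=
    { measurable := hc.measurable_f
      ae_continuous := by
        filter_upwards [hc.lipschitz_f, hc.continuous_f] with x h1 h2
        refine continuous_prod_of_continuous_lipschitzWith'
          (fun p : ℝ × Euc N => f x p.1 p.2) (Real.toNNReal K) (fun y => ?_) h2
        refine LipschitzWith.of_dist_le_mul fun z z' => ?_
        rw [Real.coe_toNNReal _ hc.pos_K.le, Real.dist_eq, dist_eq_norm]
        exact h1 y z z'
      ae_growth := by
        filter_upwards [hc.growth_f] with x h1 p
        refine (h1 p.1 p.2).trans ?_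
        have h2 := norm_fst_le p
        have h3 := norm_snd_le p
        rw [Real.norm_eq_abs] at h2
        rw [mul_comm 2 M, mul_assoc]
        exact mul_le_mul_of_nonneg_left (by linarith) hc.pos_M.le }
  boundary :=
    { measurable := hc.measurable_h
      ae_continuous := hc.continuous_h
      ae_growth := hc.growth_h }
  flux :=
    { measurable := hc.measurable_g
      ae_continuous := by
        filter_upwards [hc.lipschitz_g] with x h1
        refine LipschitzWith.continuous (K := Real.toNNReal (2 * k))
          (LipschitzWith.of_dist_le_mul fun p p' => ?_)
        rw [Real.coe_toNNReal _ (by linarith [hc.pos_k]), dist_eq_norm, dist_eq_norm]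
        refine (h1 p.1 p'.1 p.2 p'.2).trans ?_
        have h2 := norm_fst_le (p - p')
        have h3 := norm_snd_le (p - p')
        rw [Prod.fst_sub, Real.norm_eq_abs] at h2
        rw [Prod.snd_sub] at h3
        rw [mul_comm 2 k, mul_assoc]
        exact mul_le_mul_of_nonneg_left (by linarith) hc.pos_k.le
      ae_growth := by
        filter_upwards [hc.bounded_g] with x h1 p
        exact (h1 p.1 p.2).trans
          (le_mul_of_one_le_right hc.pos_M.le (by linarith [norm_nonneg p])) }

section WeakForm

variable {b : Euc N → Euc N} {q : Euc N → ℝ} {f : Euc N → ℝ → Euc N → ℝ} {h : Euc N → ℝ → ℝ}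
  {g : Euc N → ℝ → Euc N → Euc N} {Cb Cq Cf Ch Cg s : ℝ}

theorem IsAdmissible.isCaratheodory_lowerCoeff (ha : IsAdmissible D b q f h g Cb Cq Cf Ch Cg) :
    IsCaratheodory (volume.restrict D) (lowerCoeff b q f) (|(-1)| * (Cf + (Cb + Cq))) :=
  (ha.source.add (ha.drift.add ha.potential)).const_smul (-1)

theorem IsAdmissible.isCaratheodory_fluxCoeff (ha : IsAdmissible D b q f h g Cb Cq Cf Ch Cg) :
    IsCaratheodory (volume.restrict D) (fluxCoeff g) (|1 / 2| * 1 + |(-1)| * Cg) :=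
  (isCaratheodory_snd.const_smul (1 / 2)).add (ha.flux.const_smul (-1))

theorem IsAdmissible.isCaratheodory_boundaryCoeff (ha : IsAdmissible D b q f h g Cb Cq Cf Ch Cg)
    (s : ℝ) :
    IsCaratheodory (surfaceMeasure D) (boundaryCoeff s h) (|-(s / 2)| * Ch) :=
  ha.boundary.const_smul _

variable [IsFiniteMeasure (volume.restrict D)] [IsFiniteMeasure (surfaceMeasure D)]

/-- The pairing of the operator with a test function is the difference of the two sides of the weak
equation. -/
theorem IsAdmissible.inner_tripleOp_eq (ha : IsAdmissible D b q f h g Cb Cq Cf Ch Cg)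
    {U V : TripleSpace D} {u φ T : Euc N → ℝ} {G : Euc N → Euc N}
    (hu : U.fst =ᵐ[volume.restrict D] u) (hG : U.snd.fst =ᵐ[volume.restrict D] G)
    (hT : U.snd.snd =ᵐ[surfaceMeasure D] T) (hV : Represents V φ) :
    inner ℝ (tripleOp (lowerCoeff b q f) (fluxCoeff g)
      (boundaryCoeff s h) U) V =
      (1 / 2 * (∫ x in D, inner ℝ (G x) (∇ φ x)) - (∫ x in D, inner ℝ (b x) (G x) * φ x)
          - (∫ x in D, q x * u x * φ x)) -
        ((∫ x in D, f x (u x) (G x) * φ x) + (∫ x in D, inner ℝ (g x (u x) (G x)) (∇ φ x))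
          + s / 2 * ∫ x, h x (T x) * φ x ∂(surfaceMeasure D)) := by
  obtain ⟨v1, v2, v3⟩ := hV
  have hjet : jet U =ᵐ[volume.restrict D] fun x => (u x, G x) := by
    filter_upwards [hu, hG] with x h1 h2
    rw [jet, h1, h2]
  have mj : MemLp (fun x => (u x, G x)) 2 (volume.restrict D) := (memLp_jet U).ae_eq hjet
  have mφ : MemLp φ 2 (volume.restrict D) := (Lp.memLp V.fst).ae_eq v1
  have mg : MemLp (∇ φ) 2 (volume.restrict D) := (Lp.memLp V.snd.fst).ae_eq v2
  have i1 : Integrable (fun x => f x (u x) (G x) * φ x) (volume.restrict D) :=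
    (ha.source.memLp mj).integrable_mul mφ
  have i2 : Integrable (fun x => inner ℝ (b x) (G x) * φ x) (volume.restrict D) :=
    (ha.drift.memLp mj).integrable_mul mφ
  have i3 : Integrable (fun x => q x * u x * φ x) (volume.restrict D) :=
    (ha.potential.memLp mj).integrable_mul mφ
  have i4 : Integrable (fun x => inner ℝ (G x) (∇ φ x)) (volume.restrict D) :=
    isCaratheodory_snd.integrable_inner mj mg
  have i5 : Integrable (fun x => inner ℝ (g x (u x) (G x)) (∇ φ x)) (volume.restrict D) :=
    ha.flux.integrable_inner mj mg
  have i23 : Integrable (fun x => inner ℝ (b x) (G x) * φ x + q x * u x * φ x)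
      (volume.restrict D) := i2.add i3
  have hinner : ∀ a c : ℝ, inner ℝ a c = c * a := fun _ _ => rfl
  have e1 : ∫ x in D, inner ℝ (lowerCoeff b q f x (jet U x)) (V.fst x) =
      -((∫ x in D, f x (u x) (G x) * φ x) + ((∫ x in D, inner ℝ (b x) (G x) * φ x) +
        ∫ x in D, q x * u x * φ x)) := by
    rw [← integral_add i2 i3, ← integral_add i1 i23, ← integral_neg]
    refine integral_congr_ae ?_
    filter_upwards [hjet, v1] with x hx1 hx2
    simp only [hx1, hx2, lowerCoeff, smul_eq_mul, hinner]
    ring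
  have e2 : ∫ x in D, inner ℝ (fluxCoeff g x (jet U x)) (V.snd.fst x) =
      1 / 2 * (∫ x in D, inner ℝ (G x) (∇ φ x)) -
        ∫ x in D, inner ℝ (g x (u x) (G x)) (∇ φ x) := by
    rw [← integral_const_mul, ← integral_sub (i4.const_mul _) i5]
    refine integral_congr_ae ?_
    filter_upwards [hjet, v2] with x hx1 hx2
    simp only [hx1, hx2, fluxCoeff, inner_add_left, real_inner_smul_left]
    ring
  have e3 : ∫ x, inner ℝ (boundaryCoeff s h x (U.snd.snd x)) (V.snd.snd x)
      ∂(surfaceMeasure D) = -(s / 2 * ∫ x, h x (T x) * φ x ∂(surfaceMeasure D)) := by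
    rw [← integral_const_mul, ← integral_neg]
    refine integral_congr_ae ?_
    filter_upwards [hT, v3] with x hx1 hx2
    simp only [hx1, hx2, boundaryCoeff, smul_eq_mul, hinner]
    ring
  rw [inner_tripleOp ha.isCaratheodory_lowerCoeff ha.isCaratheodory_fluxCoeff
    (ha.isCaratheodory_boundaryCoeff s), e1, e2, e3]
  ring

/-- Smooth functions are among the test triples, so a Sobolev triple annihilated by all of them is a
weak solution. -/
theorem IsAdmissible.isWeakSolution (hN : 1 ≤ N) (hD : IsSmoothDomain D)
    (ha : IsAdmissible D b q f h g Cb Cq Cf Ch Cg) {U : TripleSpace D}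
    (hU : U ∈ sobolevTriples D)
    (hU0 : ∀ V ∈ sobolevTriples D, inner ℝ (tripleOp (lowerCoeff b q f)
      (fluxCoeff g) (boundaryCoeff s h) U) V = 0) :
    IsWeakSolution D s b q f h g U.fst := by
  refine ⟨U.snd.fst, U.snd.snd, hD.memH1With_of_mem_sobolevTriples hU,
    isTrace_of_mem_sobolevTriples hU, fun φ hφ => ?_⟩
  obtain ⟨V, hV⟩ := hD.exists_represents hN hφ
  have h1 := hU0 V (Submodule.le_topologicalClosure _ ⟨φ, hφ, hV⟩)
  rw [ha.inner_tripleOp_eq EventuallyEq.rfl EventuallyEq.rfl EventuallyEq.rfl hV] at h1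
  exact sub_eq_zero.1 h1

/-- Every weak solution comes from a Sobolev triple, and by density it solves the equation for all
Sobolev test triples. -/
theorem IsAdmissible.exists_triple (hN : 1 ≤ N) (hD : IsSmoothDomain D)
    (ha : IsAdmissible D b q f h g Cb Cq Cf Ch Cg) {u : Euc N → ℝ}
    (hu : IsWeakSolution D s b q f h g u) :
    ∃ U ∈ sobolevTriples D, U.fst =ᵐ[volume.restrict D] u ∧
      ∀ V ∈ sobolevTriples D, inner ℝ (tripleOp (lowerCoeff b q f)
        (fluxCoeff g) (boundaryCoeff s h) U) V = 0 := by
  obtain ⟨G, T, hH, hT, hsol⟩ := hu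
  refine ⟨mkTriple hH.memLp hH.memLp_grad hT.1,
    hT.mkTriple_mem_sobolevTriples hN hD hH.memLp hH.memLp_grad, hH.memLp.coeFn_toLp,
    fun V hV => sobolevTriples_induction (p := fun V => inner ℝ (tripleOp _ _ _ _) V = 0)
      (isClosed_eq (continuous_const.inner continuous_id) continuous_const)
      (fun V φ hφ hVφ => ?_) hV⟩
  rw [ha.inner_tripleOp_eq (U := mkTriple hH.memLp hH.memLp_grad hT.1) hH.memLp.coeFn_toLp
    hH.memLp_grad.coeFn_toLp hT.1.coeFn_toLp hVφ, hsol φ hφ, sub_self]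

end WeakForm

/-- The coefficients in the interior are strongly monotone in the jet: `k < 1 / 2` leaves a part of
the Dirichlet form, half of which absorbs the terms of first order. -/
theorem Conditions.ae_le_interior (hDm : MeasurableSet D) {α β K M k β' B Q : ℝ}
    {b : Euc N → Euc N} {q : Euc N → ℝ} {f : Euc N → ℝ → Euc N → ℝ} {h : Euc N → ℝ → ℝ}
    {g : Euc N → ℝ → Euc N → Euc N} (hc : Conditions D α β K M k β' f h g) (hk : k < 1 / 2)
    (hbB : ∀ x, ‖b x‖ ≤ B) (hqQ : ∀ x ∈ D, q x ≤ Q) :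
    ∀ᵐ x ∂(volume.restrict D), ∀ p p' : ℝ × Euc N,
      (α - Q - (B + K + k) ^ 2 / (2 * (1 / 2 - k))) * (p.1 - p'.1) ^ 2 +
          (1 / 2 - k) / 2 * ‖p.2 - p'.2‖ ^ 2 ≤
        (lowerCoeff b q f x p - lowerCoeff b q f x p') * (p.1 - p'.1) +
          inner ℝ (fluxCoeff g x p - fluxCoeff g x p') (p.2 - p'.2) := by
  filter_upwards [hc.monotone_f, hc.lipschitz_f, hc.lipschitz_g, ae_restrict_mem hDm] with
    x hmon hlip hg hx
  rintro ⟨y, z⟩ ⟨y', z'⟩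
  simp only [lowerCoeff, fluxCoeff, smul_eq_mul]
  set w := y - y' with hw
  set ζ := z - z' with hζ
  set θ := 1 / 2 - k with hθ
  have hθ0 : 0 < θ := by linarith
  have h1 : w * (f x y z - f x y' z) ≤ -α * w ^ 2 := by
    have := hmon y y' z
    rwa [sq_abs] at this
  have h2 : w * (f x y' z - f x y' z') ≤ |w| * (K * ‖ζ‖) :=
    (le_abs_self _).trans (by rw [abs_mul]; gcongr; exact hlip y' z z')
  have h3 : w * inner ℝ (b x) ζ ≤ |w| * (B * ‖ζ‖) := by
    refine (le_abs_self _).trans ?_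
    rw [abs_mul]
    gcongr
    exact (abs_real_inner_le_norm _ _).trans (by gcongr; exact hbB x)
  have h4 : q x * w ^ 2 ≤ Q * w ^ 2 := mul_le_mul_of_nonneg_right (hqQ x hx) (sq_nonneg w)
  have h5 : inner ℝ (g x y z - g x y' z') ζ ≤ k * (|w| + ‖ζ‖) * ‖ζ‖ :=
    (real_inner_le_norm _ _).trans (by gcongr; exact hg y y' z z')
  have h6 : inner ℝ (b x) z - inner ℝ (b x) z' = inner ℝ (b x) ζ := by rw [hζ, inner_sub_right]
  have h7 : inner ℝ ((1 / 2 : ℝ) • z + (-1 : ℝ) • g x y z -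
      ((1 / 2 : ℝ) • z' + (-1 : ℝ) • g x y' z')) ζ =
      1 / 2 * ‖ζ‖ ^ 2 - inner ℝ (g x y z - g x y' z') ζ := by
    rw [← real_inner_self_eq_norm_sq, ← real_inner_smul_left, ← inner_sub_left]
    congr 1
    rw [hζ]
    module
  -- Young's inequality for the mixed terms
  have h8 : (B + K + k) * (|w| * ‖ζ‖) ≤
      θ / 2 * ‖ζ‖ ^ 2 + (B + K + k) ^ 2 / (2 * θ) * w ^ 2 := by
    have h9 : 0 ≤ 1 / (2 * θ) * (θ * ‖ζ‖ - (B + K + k) * |w|) ^ 2 := by positivity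
    have h10 : 1 / (2 * θ) * (θ * ‖ζ‖ - (B + K + k) * |w|) ^ 2 =
        θ / 2 * ‖ζ‖ ^ 2 + (B + K + k) ^ 2 / (2 * θ) * w ^ 2 - (B + K + k) * (|w| * ‖ζ‖) := by
      rw [← sq_abs w]
      field_simp
      ring
    linarith
  rw [h7]
  have h11 : (-1 * (f x y z + (inner ℝ (b x) z + q x * y)) -
      -1 * (f x y' z' + (inner ℝ (b x) z' + q x * y'))) * w =
      -(w * (f x y z - f x y' z)) - w * (f x y' z - f x y' z') - w * inner ℝ (b x) ζ -
        q x * w ^ 2 := by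
    rw [← h6, hw]
    ring
  rw [h11]
  have h12 : 1 / 2 * ‖ζ‖ ^ 2 = θ * ‖ζ‖ ^ 2 + k * ‖ζ‖ ^ 2 := by rw [hθ]; ring
  rw [h12]
  linarith

/-- On the boundary only the Lipschitz bound is used, which serves both signs of `s`. -/
theorem Conditions.ae_le_boundary {α β K M k β' s : ℝ}
    {f : Euc N → ℝ → Euc N → ℝ} {h : Euc N → ℝ → ℝ}
    {g : Euc N → ℝ → Euc N → Euc N} (hc : Conditions D α β K M k β' f h g)
    (hs : s = 1 ∨ s = -1) :
    ∀ᵐ x ∂(surfaceMeasure D), ∀ y y' : ℝ,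
      -(|β'| / 2) * (y - y') ^ 2 ≤ (boundaryCoeff s h x y - boundaryCoeff s h x y') * (y - y') := by
  filter_upwards [hc.lipschitz_h] with x hx y y'
  have h1 : |(h x y - h x y') * (y - y')| ≤ |β'| * (y - y') ^ 2 := by
    rw [abs_mul, ← sq_abs (y - y'), sq, ← mul_assoc]
    gcongr
    refine (hx y y').trans ?_
    gcongr
    exact le_abs_self _
  have h2 := abs_le.1 h1
  simp only [boundaryCoeff, smul_eq_mul]
  rcases hs with rfl | rfl <;> nlinarith [h2.1, h2.2]

end NeumannProblem

theorem mainTheorem3 (N : ℕ) (hN : 1 ≤ N) (D : Set (NeumannProblem.Euc N))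
    (hD : NeumannProblem.IsSmoothDomain D) (K k β' B Q : ℝ) (hk : k < 1 / 2) :
    ∃ α₀ : ℝ, ∀ (α β M : ℝ)
      (b : NeumannProblem.Euc N → NeumannProblem.Euc N) (q : NeumannProblem.Euc N → ℝ)
      (f : NeumannProblem.Euc N → ℝ → NeumannProblem.Euc N → ℝ)
      (h : NeumannProblem.Euc N → ℝ → ℝ)
      (g : NeumannProblem.Euc N → ℝ → NeumannProblem.Euc N → NeumannProblem.Euc N) (s : ℝ),
      α₀ ≤ α →
      (∃ C₀ : NNReal, LipschitzWith C₀ b) → (∀ x, ‖b x‖ ≤ B) →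
      Measurable q → (∃ C : ℝ, ∀ x ∈ D, |q x| ≤ C) → (∀ x ∈ D, q x ≤ Q) →
      NeumannProblem.Conditions D α β K M k β' f h g →
      (s = 1 ∨ s = -1) →
      ∃ u : NeumannProblem.Euc N → ℝ,
        NeumannProblem.IsWeakSolution D s b q f h g u ∧
        ∀ v : NeumannProblem.Euc N → ℝ, NeumannProblem.IsWeakSolution D s b q f h g v →
          v =ᵐ[volume.restrict D] u := by
  have hfin := hD.isFiniteMeasure_restrict
  have hfin' := hD.isFiniteMeasure_surfaceMeasure hN
  set θ := 1 / 2 - k with hθ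
  have hθ0 : 0 < θ := by linarith
  set κ := |β'| / 2 with hκ
  have hκ0 : 0 ≤ κ := by positivity
  -- the interior leaves `θ / 2` of the gradient term; with this weight `κ + 1` times the boundary
  -- term takes half of that, and one unit of the boundary term is kept for coercivity
  obtain ⟨C, hC, htrace⟩ := hD.exists_trace_le hN (ε := θ / (4 * (κ + 1))) (by positivity)
  refine ⟨Q + (B + K + k) ^ 2 / (2 * θ) + (κ + 1) * C + 1, ?_⟩
  rintro α β M b q f h g s hα ⟨C₀, hb⟩ hbB hq ⟨Cq, hqC⟩ hqQ hc hs
  have ha := hc.isAdmissible hD.isOpen.measurableSet hb.continuous hbB hq hqC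
  set A := NeumannProblem.tripleOp (D := D) (NeumannProblem.lowerCoeff b q f)
    (NeumannProblem.fluxCoeff g) (NeumannProblem.boundaryCoeff s h) with hA
  have hmono : ∀ U ∈ NeumannProblem.sobolevTriples D, ∀ V ∈ NeumannProblem.sobolevTriples D,
      min 1 (θ / 4) * ‖U - V‖ ^ 2 ≤ inner ℝ (A U - A V) (U - V) := by
    intro U hU V hV
    have h1 := NeumannProblem.le_inner_tripleOp_sub ha.isCaratheodory_lowerCoeff
      ha.isCaratheodory_fluxCoeff
      (ha.isCaratheodory_boundaryCoeff s) (hc.ae_le_interior hD.isOpen.measurableSet hk hbB hqQ)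
      (hc.ae_le_boundary hs) U V
    refine le_trans ?_ h1
    have h2 := htrace (U - V) (Submodule.sub_mem _ hU hV)
    rw [NeumannProblem.norm_sq_triple]
    change ‖U.snd.snd - V.snd.snd‖ ^ 2 ≤ C * ‖U.fst - V.fst‖ ^ 2 +
      θ / (4 * (κ + 1)) * ‖U.snd.fst - V.snd.fst‖ ^ 2 at h2
    change min 1 (θ / 4) * (‖U.fst - V.fst‖ ^ 2 +
      (‖U.snd.fst - V.snd.fst‖ ^ 2 + ‖U.snd.snd - V.snd.snd‖ ^ 2)) ≤ _
    rw [← hθ, ← hκ]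
    have hX := sq_nonneg ‖U.fst - V.fst‖
    have hY := sq_nonneg ‖U.snd.fst - V.snd.fst‖
    have hZ := sq_nonneg ‖U.snd.snd - V.snd.snd‖
    set X := ‖U.fst - V.fst‖ ^ 2
    set Y := ‖U.snd.fst - V.snd.fst‖ ^ 2
    set Z := ‖U.snd.snd - V.snd.snd‖ ^ 2
    have h3 : (κ + 1) * Z ≤ (κ + 1) * C * X + θ / 4 * Y := by
      have h4 := mul_le_mul_of_nonneg_left h2 (by positivity : 0 ≤ κ + 1)
      have h5 : (κ + 1) * (C * X + θ / (4 * (κ + 1)) * Y) = (κ + 1) * C * X + θ / 4 * Y := by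
        field_simp
      linarith
    have h6 : ((κ + 1) * C + 1) * X ≤ (α - Q - (B + K + k) ^ 2 / (2 * θ)) * X :=
      mul_le_mul_of_nonneg_right (by linarith) hX
    have h7 := mul_le_mul_of_nonneg_right (min_le_left 1 (θ / 4)) hX
    have h8 := mul_le_mul_of_nonneg_right (min_le_right 1 (θ / 4)) hY
    have h9 := mul_le_mul_of_nonneg_right (min_le_left 1 (θ / 4)) hZ
    linarith
  obtain ⟨U, hU, hU0, huniq⟩ :=
    (NeumannProblem.sobolevTriples D).exists_unique_inner_eq_zero_of_stronglyMonotone A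
      (by positivity) hmono (fun U _ V _ => NeumannProblem.tendsto_inner_tripleOp
        ha.isCaratheodory_lowerCoeff
        ha.isCaratheodory_fluxCoeff (ha.isCaratheodory_boundaryCoeff s) U V)
  refine ⟨U.fst, ha.isWeakSolution hN hD hU hU0, fun v hv => ?_⟩
  obtain ⟨V, hV, hVv, hV0⟩ := ha.exists_triple hN hD hv
  rw [huniq V hV hV0] at hVv
  exact hVv.symm
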